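/- Let $D$ be a finite set. A nondeterministic $D$-way branching program with $n$ inputs is a finite connected directed acyclic multigraph with a distinguished source; each node is either a sink, which has no out-edges and carries an output label, or is labeled with an input index in $[n]$, and every edge is labeled with an element of $D$. It is deterministic if each non-sink node has precisely one out-edge for each label in $D$. Its size is its number of nodes, and its length is the maximal length of a path from the source to a sink. It is oblivious if the sequence of input indices queried is the same on all paths from the source to a sink, and read-once if no index occurs twice on such a path. On input $x\in D^n$ one follows, from a node labeled $i$, edges labeled $x_i$. A deterministic program computes $f$ if every $x$ leads to a sink labeled $f(x)$; a nondeterministic program computes a Boolean function $f$ if $f(x)=1$ exactly when some path followed by $x$ leads to a sink labeled $1$. For $n\ge 1$ let $\mathrm{MedianBit}_n:\{1,\dots,2n\}^n\to\{0,1\}$ be the low-order bit of the median, i.e. of the $\lceil n/2\rceil$-th largest (counted with multiplicity) of the $n$ input values. 1. There are absolute constants $c,C>0$ such that for all real $k$, all $n\ge 2$ and all $T\le kn$, every deterministic oblivious branching program of length at most $T$ computing $\mathrm{MedianBit}_n$ has size at least $$2^{\,c\,n^{1/2^{4k+2}}/(\log n)^{C}},$$ that is, size $2^{\tilde\Omega(n^{1/2^{4k+2}})}$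 uniformly in $k$. 2. If $T:\mathbb N\to\mathbb N$ satisfies $T(n)=o(n\log\log n)$, then for every $a$ and all sufficiently large $n$, every deterministic oblivious branching program of length at most $T(n)$ computing $\mathrm{MedianBit}_n$ has size greater than $n^a$. 3. There is a constant $K$ such that for every $n\ge1$ both $\mathrm{MedianBit}_n$ and its complement are computed by nondeterministic oblivious read-once branching programs of length at most $n$ and size at most $Kn^4$. 4. For $T:\mathbb N\to\mathbb N$ let $\mathsf P_T$ (respectively $\mathsf{NP}_T$) be the class of families $(f_n)_{n\ge1}$ of functions $f_n:\{1,\dots,2n\}^n\to\{0,1\}$ computed by deterministic (respectively nondeterministic) oblivious branching programs of length at most $T(n)$ and size polynomial in $n$, and let $\mathsf{coNP}_T$ be the class of families of complements of the members of $\mathsf{NP}_T$. If $T(n)\ge n$ for all $n\ge1$ and $T(n)=o(n\log\log n)$, then $(\mathrm{MedianBit}_n)_n\in(\mathsf{NP}_T\cap\mathsf{coNP}_T)\setminus\mathsf P_T$; in particular $\mathsf P_T\ne\mathsf{NP}_T\cap\mathsf{coNP}_T$. -/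

import Mathlib

open Filter Asymptotics

/-- A (possibly nondeterministic) `D`-way branching program with `n` inputs and output labels in `R`:
a finite connected directed acyclic multigraph with a source.  A node is either labelled by an input
index (`Sum.inl i`) or it is a sink labelled by an output value (`Sum.inr r`).  `Edge u d v` says that
there is an edge from `u` to `v` labelled with the symbol `d`. -/
structure BranchingProgram (n : ℕ) (D R : Type) where
  /-- the nodes -/
  V : Type
  [fintypeV : Fintype V]
  source : V
  label : V → Fin n ⊕ R
  Edge : V → D → V → Prop
  sink_no_edge : ∀ u r d v, label u = Sum.inr r → ¬ Edge u d v
  acyclic : ∀ v, ¬ Relation.TransGen (fun a b => ∃ d, Edge a d b) v v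
  connected : ∀ u v, Relation.EqvGen (fun a b => ∃ d, Edge a d b) u v

namespace BranchingProgram

variable {n : ℕ} {D R : Type}

/-- The size of a branching program is its number of nodes. -/
def size (B : BranchingProgram n D R) : ℕ :=
  letI := B.fintypeV
  Fintype.card B.V

/-- Each non-sink node has precisely one out-edge labelled by each symbol. -/
def IsDeterministic (B : BranchingProgram n D R) : Prop :=
  ∀ u i, B.label u = Sum.inl i → ∀ d, ∃! v, B.Edge u d v

/-- `B.IsPath u s v`: there is a path of the graph from `u` to `v` along which the sequence of
queried input indices is `s`; the length of the path is `s.length`. -/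
inductive IsPath (B : BranchingProgram n D R) : B.V → List (Fin n) → B.V → Prop
  | nil (v : B.V) : IsPath B v [] v
  | cons {u v w : B.V} {i : Fin n} {d : D} {s : List (Fin n)} :
      B.label u = Sum.inl i → B.Edge u d v → IsPath B v s w → IsPath B u (i :: s) w

/-- `s` is the sequence of input indices on some path from the source to a sink. -/
def IsSourceSinkSeq (B : BranchingProgram n D R) (s : List (Fin n)) : Prop :=
  ∃ v r, B.label v = Sum.inr r ∧ B.IsPath B.source s v

/-- The sequence of input indices is the same on all paths from the source to a sink. -/
def IsOblivious (B : BranchingProgram n D R) : Prop :=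
  ∀ s t, B.IsSourceSinkSeq s → B.IsSourceSinkSeq t → s = t

/-- The program has length (time) at most `T`: so has every path from the source to a sink. -/
def LengthLE (B : BranchingProgram n D R) (T : ℕ) : Prop :=
  ∀ s, B.IsSourceSinkSeq s → s.length ≤ T

/-- No input index appears more than once on any path from the source to a sink. -/
def IsReadOnce (B : BranchingProgram n D R) : Prop :=
  ∀ s, B.IsSourceSinkSeq s → s.Nodup

/-- On input `x`, some path that follows the edges labelled by the values of the queried inputs
leads from the source to the node `v`. -/
def Reaches (B : BranchingProgram n D R) (x : Fin n → D) (v : B.V) : Prop :=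
  Relation.ReflTransGen (fun a b => ∃ i, B.label a = Sum.inl i ∧ B.Edge a (x i) b) B.source v

/-- Every input `x` leads to a sink, and the label of the sink reached is `f x`. -/
def Computes (B : BranchingProgram n D R) (f : (Fin n → D) → R) : Prop :=
  ∀ x, (∃ v, B.Reaches x v ∧ B.label v = Sum.inr (f x)) ∧
    ∀ v r, B.Reaches x v → B.label v = Sum.inr r → r = f x

/-- Nondeterministic computation of a Boolean function: `f x` is true if and only if some path
followed by `x` leads to an accepting sink. -/
def NondetComputes (B : BranchingProgram n D Bool) (f : (Fin n → D) → Bool) : Prop :=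
  ∀ x, f x = true ↔ ∃ v, B.Reaches x v ∧ B.label v = Sum.inr true

end BranchingProgram

/-- The set `{1, …, 2n}` of input values. -/
abbrev InputValue (n : ℕ) : Type := ↥(Finset.Icc 1 (2 * n))

/-- The median of `n ≥ 1` values: the `⌈n/2⌉`-th largest one, with multiplicity, which has position
`⌊n/2⌋`, counted from `0`, in nondecreasing order. -/
def median {n : ℕ} (hn : 0 < n) (x : Fin n → InputValue n) : InputValue n :=
  x (Tuple.sort x ⟨n / 2, Nat.div_lt_self hn one_lt_two⟩)

/-- A family of Boolean functions, the `n`-th one of `n` inputs from `{1, …, 2n}`. -/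
abbrev BoolFamily : Type := (n : ℕ) → (Fin n → InputValue n) → Bool

/-- The low-order bit of the median (with a value of no importance for `n = 0`). -/
def medianBit : BoolFamily := fun n x =>
  if hn : 0 < n then ((median hn x : InputValue n) : ℕ).testBit 0 else false

/-- Families computed by deterministic oblivious branching programs of length at most `T n` and
polynomial size. -/
def ObliviousP (T : ℕ → ℕ) : Set BoolFamily :=
  {f | ∃ c : ℕ, ∀ n : ℕ, 1 ≤ n → ∃ B : BranchingProgram n (InputValue n) Bool,
    B.IsDeterministic ∧ B.IsOblivious ∧ B.LengthLE (T n) ∧ B.Computes (f n) ∧ B.size ≤ c * n ^ c}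

/-- Families computed by nondeterministic oblivious branching programs of length at most `T n` and
polynomial size. -/
def ObliviousNP (T : ℕ → ℕ) : Set BoolFamily :=
  {f | ∃ c : ℕ, ∀ n : ℕ, 1 ≤ n → ∃ B : BranchingProgram n (InputValue n) Bool,
    B.IsOblivious ∧ B.LengthLE (T n) ∧ B.NondetComputes (f n) ∧ B.size ≤ c * n ^ c}

/-- Families whose complement is in `ObliviousNP T`. -/
def ObliviousCoNP (T : ℕ → ℕ) : Set BoolFamily :=
  {f | (fun n x => !(f n x)) ∈ ObliviousNP T}

/-! Lower bound. A deterministic oblivious program processes one fixed query sequence. If its length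
is at most `k * n`, more than half of the inputs are read at most `p = ⌊2k⌋` times. Among these
there are disjoint sets `A`, `B`, each of at least `n / (8 * 2 ^ (2p))` inputs, between which the
sequence alternates in at most `4p` blocks (`exists_alternates_of_length`). The owners of `A` and
`B` can then simulate the program by sending `4p` messages, each the current node
(`Alternates.solvable`).

Such protocols are ruled out by round elimination (`Hard.succ`): from a game hard for `d` messages
one forms `t` copies, where the player who does not know which copy counts must speak first. A
message from a set small against `(4/3) ^ (t/2)` says too little about most copies, so one message
can be removed. Each of these games is a selection problem (`SelectionGame.succ`): the copies occupy
consecutive intervals, and padding by extreme values moves the fixed rank into the copy that counts.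
It fits inside the median problem when `8 * (4t) ^ (4p) ≤ n`, so the size is exponential in `t`,
which is of order `n ^ (1/(4p))`.

Upper bound. A nondeterministic program guesses the median with its first query and verifies it by
counting the values below it and those at most it. -/

/-! ### Two-party protocols and round elimination. -/

/-- `Solvable W d X Y f`: on `X × Y` the function `f` is computed by a two-party protocol with `d`
messages from `W`, sent in turn, the first one by the owner of the first argument. -/
def Solvable (W : Type) : ℕ → ∀ {X Y : Type}, Set X → Set Y → (X → Y → Bool) → Prop
  | 0, _, _, X', Y', f => ∃ b, ∀ x ∈ X', ∀ y ∈ Y', f x y = b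
  | d + 1, X, _, X', Y', f =>
    ∃ g : X → W, ∀ w, Solvable W d Y' {x | x ∈ X' ∧ g x = w} (fun y x => f x y)

/-- Each player translates privately and then runs the old protocol, so no message is added. -/
theorem Solvable.comap {W : Type} {d : ℕ} : ∀ {X Y A B : Type} {X' : Set X} {Y' : Set Y}
    {A' : Set A} {B' : Set B} {f : X → Y → Bool} {h : A → B → Bool} (φ : A → X) (ψ : B → Y),
    (∀ a ∈ A', φ a ∈ X') → (∀ b ∈ B', ψ b ∈ Y') →
    (∀ a ∈ A', ∀ b ∈ B', h a b = f (φ a) (ψ b)) → Solvable W d X' Y' f → Solvable W d A' B' h := by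
  induction d with
  | zero =>
    rintro X Y A B X' Y' A' B' f h φ ψ hφ hψ hf ⟨c, hc⟩
    exact ⟨c, fun a ha b hb => by rw [hf a ha b hb, hc _ (hφ a ha) _ (hψ b hb)]⟩
  | succ d ih =>
    rintro X Y A B X' Y' A' B' f h φ ψ hφ hψ hf ⟨g, hg⟩
    refine ⟨g ∘ φ, fun w => ih ψ φ hψ ?_ ?_ (hg w)⟩
    · rintro a ⟨ha, hw⟩
      exact ⟨hφ a ha, hw⟩
    · rintro b hb a ⟨ha, _⟩
      exact hf a ha b hb

/-- No protocol with `d` messages computes `f` on a product of two dense sets. -/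
def Hard (W : Type) (d : ℕ) {S O : Type} [Fintype S] [Fintype O] (f : S → O → Bool) : Prop :=
  ∀ (S' : Finset S) (O' : Finset O), Fintype.card S ≤ 2 * S'.card →
    3 * Fintype.card O ≤ 4 * O'.card → ¬ Solvable W d (S' : Set S) (O' : Set O) f

/-- Three quarters of a two-element set is the whole set, so both bits survive and no constant
answer is correct. -/
theorem hard_zero (W : Type) : Hard W 0 (fun (_ : Unit) (b : Bool) => b) := by
  rintro S' O' hS hO ⟨c, hc⟩
  have h1 : S'.Nonempty := by
    rw [← Finset.card_pos]; simp at hS; omega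
  obtain ⟨u, hu⟩ := h1
  have h2 : O' = Finset.univ := by
    rw [← Finset.card_eq_iff_eq_univ]
    have := Finset.card_le_univ O'
    simp at hO this ⊢; omega
  have h3 := hc u hu true (by simp [h2])
  have h4 := hc u hu false (by simp [h2])
  simp [← h3] at h4

/-- Some fibre of a map to a small set is large. -/
theorem exists_large_fiber {S W : Type} [Fintype W] [DecidableEq W] (S' : Finset S) (g : S → W)
    (hS : S'.Nonempty) : ∃ w, S'.card ≤ Fintype.card W * (S'.filter (g · = w)).card := by
  by_contra! h
  obtain ⟨x, hx⟩ := hS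
  have : Nonempty W := ⟨g x⟩
  have h1 : S'.card = ∑ w, (S'.filter (g · = w)).card :=
    Finset.card_eq_sum_card_fiberwise (t := Finset.univ) (by simp)
  have h2 : ∑ w : W, Fintype.card W * (S'.filter (g · = w)).card < ∑ w : W, S'.card :=
    Finset.sum_lt_sum_of_nonempty Finset.univ_nonempty fun w _ => h w
  rw [← Finset.mul_sum, ← h1] at h2
  simp at h2

/-- A set of vectors with many sparse projections is sparse. -/
theorem card_mul_pow_le {t : ℕ} {Ω : Type} [Fintype Ω] [DecidableEq Ω] (C : Finset (Fin t → Ω))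
    (J : Finset (Fin t)) (hJ : ∀ j ∈ J, 4 * (C.image (· j)).card ≤ 3 * Fintype.card Ω) :
    4 ^ J.card * C.card ≤ 3 ^ J.card * Fintype.card Ω ^ t := by
  classical
  have h1 : C.card ≤ ∏ j, (C.image (· j)).card := by
    rw [← Fintype.card_piFinset]
    refine Finset.card_le_card fun x hx => ?_
    rw [Fintype.mem_piFinset]
    exact fun j => Finset.mem_image_of_mem _ hx
  have h2 : ∏ j : Fin t, ((if j ∈ J then 4 else 1) * (C.image (· j)).card) ≤
      ∏ j : Fin t, ((if j ∈ J then 3 else 1) * Fintype.card Ω) := by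
    refine Finset.prod_le_prod' fun j _ => ?_
    split_ifs with h
    · exact hJ j h
    · simpa using Finset.card_le_univ _
  rw [Finset.prod_mul_distrib, Finset.prod_mul_distrib] at h2
  simp only [Finset.prod_ite_mem, Finset.univ_inter, Finset.prod_const, Finset.card_univ,
    Fintype.card_fin] at h2
  exact (Nat.mul_le_mul_left _ h1).trans h2

/-- In a dense set of pairs of an index and a vector, at most half of the indices go with a sparse
set of the entries that they point to. -/
theorem two_mul_card_sparse_le {t : ℕ} {Ω : Type} [Fintype Ω] [DecidableEq Ω] [Nonempty Ω]
    (C : Finset (Fin t × (Fin t → Ω))) (hC : 3 * (t * Fintype.card Ω ^ t) ≤ 4 * C.card)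
    (J : Finset (Fin t))
    (hJ : ∀ j ∈ J, 2 * ((C.filter (·.1 = j)).image (fun p => p.2 j)).card ≤ Fintype.card Ω) :
    2 * J.card ≤ t := by
  classical
  set q := Fintype.card Ω with hq
  have hq0 : 0 < q := Fintype.card_pos
  -- Once the index is fixed to `j`, only the vector varies; its entry `j` lies in the projection
  -- and the others are free.
  have key : ∀ j, (C.filter (·.1 = j)).card ≤
      ((C.filter (·.1 = j)).image (fun p => p.2 j)).card * q ^ (t - 1) := by
    intro j
    set P := (C.filter (·.1 = j)).image (fun p => p.2 j)
    have : (C.filter (·.1 = j)).card ≤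
        (Fintype.piFinset fun i => if i = j then P else Finset.univ).card := by
      refine Finset.card_le_card_of_injOn (fun p => p.2) ?_ ?_
      · intro p hp
        simp only [Finset.coe_filter, Set.mem_ofPred_eq] at hp
        simp only [Finset.mem_coe, Fintype.mem_piFinset]
        intro i
        split_ifs with h
        · subst h
          exact Finset.mem_image.2 ⟨p, by simp [hp], rfl⟩
        · simp
      · rintro ⟨a, x⟩ ha ⟨b, y⟩ hb hxy
        simp only [Finset.coe_filter, Set.mem_ofPred_eq] at ha hb hxy
        simp [ha.2, hb.2, hxy]
    refine this.trans (le_of_eq ?_)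
    rw [Fintype.card_piFinset, ← Finset.mul_prod_erase _ _ (Finset.mem_univ j)]
    rw [if_pos rfl, Finset.prod_congr rfl (g := fun _ => q)]
    · simp [Finset.card_erase_of_mem]
    · intro i hi
      rw [if_neg (Finset.ne_of_mem_erase hi), Finset.card_univ]
  have h1 : C.card = ∑ j, (C.filter (·.1 = j)).card :=
    Finset.card_eq_sum_card_fiberwise (t := Finset.univ) (by simp)
  -- A sparse index loses half of its fibre. Summed over `j` this reads `2|C| + |J| q^t ≤ 2 t q^t`,
  -- and density 3/4 of `C` leaves `|J| ≤ t / 2`.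
  have h2 : ∀ j : Fin t, 2 * (C.filter (·.1 = j)).card + (if j ∈ J then q ^ t else 0)
      ≤ 2 * q ^ t := by
    intro j
    have ht : q ^ t = q * q ^ (t - 1) := by
      rw [← pow_succ', Nat.sub_add_cancel (Nat.succ_le_of_lt (Fin.pos j))]
    split_ifs with h
    · have := (Nat.mul_le_mul_left 2 (key j)).trans_eq (mul_assoc _ _ _).symm
      have h3 := this.trans (Nat.mul_le_mul_right _ (hJ j h))
      omega
    · have h3 := (key j).trans (Nat.mul_le_mul_right _ (Finset.card_le_univ _))
      rw [← ht] at h3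
      omega
  have h3 := Finset.sum_le_sum fun j (_ : j ∈ Finset.univ) => h2 j
  rw [Finset.sum_add_distrib, ← Finset.mul_sum, ← h1] at h3
  simp only [Finset.sum_ite_mem, Finset.univ_inter, Finset.sum_const, Finset.card_univ,
    Fintype.card_fin, smul_eq_mul] at h3
  have h4 : (2 * J.card) * q ^ t ≤ t * q ^ t := by nlinarith
  exact Nat.le_of_mul_le_mul_right h4 (by positivity)

/-- Elimination of the first message: the owner of a vector of inputs speaks first, and the other
player knows which entry matters. -/
theorem Hard.succ {W : Type} [Fintype W] {d t : ℕ} {S O : Type} [Fintype S] [Fintype O]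
    [Nonempty S] [Nonempty O] {f : S → O → Bool} (hf : Hard W d f)
    (hW : 4 * Fintype.card W ^ 2 * 3 ^ t < 4 ^ t) :
    Hard W (d + 1) (fun (s : Fin t → O) (p : Fin t × (Fin t → S)) => f (p.2 p.1) (s p.1)) := by
  classical
  rintro S' O' hS hO ⟨g, hg⟩
  simp only [Fintype.card_fun, Fintype.card_fin, Fintype.card_prod] at hS hO
  have hO0 : 0 < Fintype.card O := Fintype.card_pos
  have hS' : S'.Nonempty := by
    rw [← Finset.card_pos]
    have : 0 < Fintype.card O ^ t := by positivity
    omega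
  -- The first message is fixed to a most popular value; the inputs sending it still have density at
  -- least `1 / (2|W|)`.
  obtain ⟨w, hw⟩ := exists_large_fiber S' g hS'
  set C := S'.filter (g · = w) with hC
  set J₁ := (Finset.univ : Finset (Fin t)).filter
    fun j => 4 * (C.image (· j)).card ≤ 3 * Fintype.card O with hJ₁
  set J₂ := (Finset.univ : Finset (Fin t)).filter fun j =>
    2 * ((O'.filter (·.1 = j)).image (fun p => p.2 j)).card ≤ Fintype.card S with hJ₂
  have h1 := card_mul_pow_le C J₁ (by simp [hJ₁])
  have h2 := two_mul_card_sparse_le O' hO J₂ (by simp [hJ₂])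
  -- Otherwise the density of `C` would be at most `(3/4) ^ (t/2)`, against `hW`. The inequality is
  -- squared to avoid halving `t`.
  have h3 : 2 * J₁.card < t := by
    by_contra! h
    have h4 : 4 ^ J₁.card ≤ 3 ^ J₁.card * (2 * Fintype.card W) := by
      have h5 : 4 ^ J₁.card * Fintype.card O ^ t ≤
          3 ^ J₁.card * (2 * Fintype.card W) * Fintype.card O ^ t := by
        calc 4 ^ J₁.card * Fintype.card O ^ t
            ≤ 4 ^ J₁.card * (2 * (Fintype.card W * C.card)) := by gcongr; omega
          _ = (2 * Fintype.card W) * (4 ^ J₁.card * C.card) := by ring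
          _ ≤ (2 * Fintype.card W) * (3 ^ J₁.card * Fintype.card O ^ t) := by gcongr
          _ = _ := by ring
      exact Nat.le_of_mul_le_mul_right h5 (by positivity)
    have h5 : 4 ^ (2 * J₁.card) ≤ 4 * Fintype.card W ^ 2 * 3 ^ (2 * J₁.card) := by
      calc 4 ^ (2 * J₁.card) = (4 ^ J₁.card) ^ 2 := by rw [mul_comm, pow_mul]
        _ ≤ (3 ^ J₁.card * (2 * Fintype.card W)) ^ 2 := by gcongr
        _ = _ := by rw [mul_comm 2 J₁.card, pow_mul]; ring
    obtain ⟨e, he⟩ := Nat.exists_eq_add_of_le h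
    rw [he, pow_add, pow_add] at h5
    have h6 : 4 * Fintype.card W ^ 2 * 3 ^ t * 3 ^ e < 4 ^ t * 4 ^ e := by
      calc _ < 4 ^ t * 3 ^ e := by gcongr
        _ ≤ _ := by gcongr; norm_num
    rw [← mul_assoc] at h5
    omega
  obtain ⟨j, hj⟩ : ∃ j, j ∉ J₁ ∪ J₂ := by
    by_contra! h
    have h4 : (Finset.univ : Finset (Fin t)).card ≤ (J₁ ∪ J₂).card :=
      Finset.card_le_card fun j _ => h j
    have h5 := Finset.card_union_le J₁ J₂
    simp only [Finset.card_univ, Fintype.card_fin] at h4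
    omega
  simp only [Finset.mem_union, hJ₁, hJ₂, Finset.mem_filter, Finset.mem_univ, true_and, not_or,
    not_le] at hj
  -- At a copy `j` outside `J₁ ∪ J₂`, inputs of the old game extend to inputs in `C` and in `O'`
  -- with index `j`; the rest of the protocol, run on these, would solve the old game with one
  -- message fewer. Values outside the projections get a dummy extension.
  have hφ : ∀ o, ∃ s, o ∈ C.image (· j) → s ∈ C ∧ s j = o := by
    intro o
    by_cases h : o ∈ C.image (· j)
    · obtain ⟨s, hs, rfl⟩ := Finset.mem_image.1 h
      exact ⟨s, fun _ => ⟨hs, rfl⟩⟩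
    · exact ⟨fun _ => o, fun h' => absurd h' h⟩
  have hψ : ∀ s, ∃ p, s ∈ (O'.filter (·.1 = j)).image (fun p => p.2 j) →
      p ∈ O' ∧ p.1 = j ∧ p.2 j = s := by
    intro s
    by_cases h : s ∈ (O'.filter (·.1 = j)).image (fun p => p.2 j)
    · obtain ⟨p, hp, rfl⟩ := Finset.mem_image.1 h
      rw [Finset.mem_filter] at hp
      exact ⟨p, fun _ => ⟨hp.1, hp.2, rfl⟩⟩
    · exact ⟨(j, fun _ => s), fun h' => absurd h' h⟩
  choose φ hφ using hφ
  choose ψ hψ using hψ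
  refine hf _ _ hj.2.le hj.1.le (Solvable.comap ψ φ ?_ ?_ ?_ (hg w))
  · exact fun s hs => (hψ s hs).1
  · intro o ho
    have := (hφ o ho).1
    rw [hC, Finset.mem_filter] at this
    exact this
  · intro s hs o ho
    obtain ⟨-, h5, h6⟩ := hψ s hs
    simp only
    rw [h5, h6, (hφ o ho).2]

/-! ### Hard games as selection problems. -/

/-- A two-party function given by a selection problem: the parties translate their inputs into
`α` and `β` numbers from `{1, …, w}`, and the value of the function is the parity of the number of
rank `ρ` (counted from `0`) among these `N` numbers. -/
structure SelectionGame (N w : ℕ) where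
  S : Type
  O : Type
  [fintypeS : Fintype S]
  [fintypeO : Fintype O]
  [nonemptyS : Nonempty S]
  [nonemptyO : Nonempty O]
  f : S → O → Bool
  α : ℕ
  β : ℕ
  ρ : ℕ
  encS : S → Multiset ℕ
  encO : O → Multiset ℕ
  card_encS : ∀ s, (encS s).card = α
  card_encO : ∀ o, (encO o).card = β
  add_eq : α + β = N
  rank_lt : ρ < N
  encS_mem : ∀ s, ∀ a ∈ encS s, 1 ≤ a ∧ a ≤ w
  encO_mem : ∀ o, ∀ a ∈ encO o, 1 ≤ a ∧ a ≤ w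
  select : ∀ s o, ∃ v, 1 ≤ v ∧ v ≤ w ∧ v.testBit 0 = f s o ∧
    (encS s + encO o).countP (· < v) ≤ ρ ∧ ρ < (encS s + encO o).countP (· ≤ v)

namespace SelectionGame

attribute [instance] fintypeS fintypeO nonemptyS nonemptyO

/-- The game in which one player holds a bit. -/
def bit : SelectionGame 1 2 where
  S := Unit
  O := Bool
  f := fun _ b => b
  α := 0
  β := 1
  ρ := 0
  encS := fun _ => 0
  encO := fun b => {if b then 1 else 2}
  card_encS := by simp
  card_encO := by simp
  add_eq := rfl
  rank_lt := one_pos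
  encS_mem := by simp
  encO_mem := by intro b; cases b <;> simp
  select := by
    intro _ b
    refine ⟨if b then 1 else 2, ?_⟩
    cases b <;> decide

variable {N w t : ℕ}

theorem countP_sum_shift (p : ℕ → Prop) [DecidablePred p] (m : Fin t → Multiset ℕ) :
    (∑ i, (m i).map (· + i * w)).countP p = ∑ i, (m i).countP fun a => p (a + i * w) := by
  rw [← Multiset.coe_countPAddMonoidHom, map_sum]
  refine Finset.sum_congr rfl fun i _ => ?_
  rw [Multiset.coe_countPAddMonoidHom, Multiset.countP_map, Multiset.countP_eq_card_filter]

theorem sum_ite_lt (j : Fin t) (N c : ℕ) :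
    ∑ i : Fin t, ((if i < j then N else 0) + if i = j then c else 0) = j * N + c := by
  rw [Finset.sum_add_distrib]
  have : (Finset.univ.filter (· < j)).card = j := by
    rw [Finset.filter_gt_eq_Iio, Fin.card_Iio]
  simp [Finset.sum_ite, this]

theorem sum_shift_mem {m : Fin t → Multiset ℕ} (hm : ∀ i, ∀ a ∈ m i, 1 ≤ a ∧ a ≤ w) {a : ℕ}
    (ha : a ∈ ∑ i, (m i).map (· + i * w)) : 1 ≤ a ∧ a ≤ t * w := by
  rw [Multiset.mem_sum] at ha
  obtain ⟨i, -, hi⟩ := ha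
  rw [Multiset.mem_map] at hi
  obtain ⟨b, hb, rfl⟩ := hi
  have := hm i b hb
  have h1 : ((i : ℕ) + 1) * w ≤ t * w := Nat.mul_le_mul_right _ i.2
  rw [add_mul, one_mul] at h1
  omega

/-- The numbers of the games `i : Fin t` on consecutive intervals, with `j * N` large and
`(t - 1 - j) * N` small numbers added, have the same number of rank `(t - 1) * N + ρ` as the game
`j` has of rank `ρ`. -/
theorem select_shift (m : Fin t → Multiset ℕ) (hm : ∀ i, ∀ a ∈ m i, 1 ≤ a ∧ a ≤ w)
    (hN : ∀ i, (m i).card = N) {ρ v : ℕ} (j : Fin t) (hv : 1 ≤ v) (hvw : v ≤ w)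
    (h1 : (m j).countP (· < v) ≤ ρ) (h2 : ρ < (m j).countP (· ≤ v)) :
    (∑ i, (m i).map (· + i * w) + (Multiset.replicate ((t - 1 - j) * N) 1 +
      Multiset.replicate (j * N) (t * w))).countP (· < v + j * w) ≤ (t - 1) * N + ρ ∧
    (t - 1) * N + ρ < (∑ i, (m i).map (· + i * w) + (Multiset.replicate ((t - 1 - j) * N) 1 +
      Multiset.replicate (j * N) (t * w))).countP (· ≤ v + j * w) := by
  have hj : ((j : ℕ) + 1) * w ≤ t * w := Nat.mul_le_mul_right _ j.2
  rw [add_mul, one_mul] at hj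
  -- Below game `j` lie the `j * N` numbers of earlier games and the `(t - 1 - j) * N` added ones,
  -- together a number independent of `j`. The large padding only makes the total size independent
  -- of `j`.
  have hN' : (t - 1) * N = (t - 1 - j) * N + j * N := by
    rw [← add_mul]; congr 1; omega
  have hlt : ∀ i : Fin t, i < j → (i : ℕ) * w + w ≤ j * w := by
    intro i hi
    have : ((i : ℕ) + 1) * w ≤ j * w := Nat.mul_le_mul_right _ hi
    rwa [add_mul, one_mul] at this
  have hgt : ∀ i : Fin t, j < i → (j : ℕ) * w + w ≤ i * w := by
    intro i hi
    have : ((j : ℕ) + 1) * w ≤ i * w := Nat.mul_le_mul_right _ hi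
    rwa [add_mul, one_mul] at this
  constructor
  · rw [Multiset.countP_add, countP_sum_shift, Multiset.countP_add]
    have e1 : ∑ i, (m i).countP (fun a => a + i * w < v + j * w) ≤ j * N + ρ := by
      rw [← sum_ite_lt]
      refine Finset.sum_le_sum fun i _ => ?_
      rcases lt_trichotomy i j with h | h | h
      · rw [if_pos h, ← hN i]
        exact (Multiset.countP_le_card _ _).trans (Nat.le_add_right _ _)
      · subst h
        simpa using h1
      · have : (m i).countP (fun a => a + i * w < v + j * w) = 0 := by
          rw [Multiset.countP_eq_zero]
          intro a ha
          have := hm i a ha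
          have := hgt i h
          omega
        omega
    have e2 : (Multiset.replicate ((t - 1 - j) * N) 1).countP (· < v + j * w) ≤
        (t - 1 - j) * N := (Multiset.countP_le_card _ _).trans (by simp)
    have e3 : (Multiset.replicate (j * N) (t * w)).countP (· < v + j * w) = 0 := by
      rw [Multiset.countP_eq_zero]
      intro a ha
      rw [Multiset.eq_of_mem_replicate ha]
      omega
    omega
  · rw [Multiset.countP_add, countP_sum_shift, Multiset.countP_add]
    have e1 : j * N + (ρ + 1) ≤ ∑ i, (m i).countP (fun a => a + i * w ≤ v + j * w) := by
      rw [← sum_ite_lt]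
      refine Finset.sum_le_sum fun i _ => ?_
      rcases lt_trichotomy i j with h | h | h
      · rw [if_pos h, if_neg h.ne, ← hN i, add_zero]
        refine le_of_eq (Multiset.countP_eq_card.2 fun a ha => ?_).symm
        have := hm i a ha
        have := hlt i h
        omega
      · subst h
        simpa using h2
      · simp [h.not_gt, h.ne']
    have e2 : (Multiset.replicate ((t - 1 - j) * N) 1).countP (· ≤ v + j * w) =
        (t - 1 - j) * N := by
      conv_rhs => rw [← Multiset.card_replicate ((t - 1 - j) * N) 1]
      refine Multiset.countP_eq_card.2 fun a ha => ?_
      rw [Multiset.eq_of_mem_replicate ha]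
      omega
    omega

/-- The game in which one player holds `t` inputs of the old game, the other player holds `t`
inputs and an index, and the old game is to be played at this index. -/
def succ (G : SelectionGame N w) (hw : Even w) (ht : 0 < t) :
    SelectionGame ((2 * t - 1) * N) (t * w) where
  -- The roles swap: the old second player now speaks first, without knowing the index.
  S := Fin t → G.O
  O := Fin t × (Fin t → G.S)
  nonemptyO := ⟨⟨0, ht⟩, fun _ => Classical.arbitrary _⟩
  f := fun s p => G.f (p.2 p.1) (s p.1)
  α := t * G.β
  β := t * G.α + (t - 1) * N
  ρ := (t - 1) * N + G.ρ
  encS := fun s => ∑ i, (G.encO (s i)).map (· + i * w)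
  encO := fun p => ∑ i, (G.encS (p.2 i)).map (· + i * w) +
    (Multiset.replicate ((t - 1 - p.1) * N) 1 + Multiset.replicate (p.1 * N) (t * w))
  card_encS := by intro s; simp [G.card_encO]
  card_encO := by
    intro p
    have : (t - 1 - (p.1 : ℕ)) * N + p.1 * N = (t - 1) * N := by
      rw [← add_mul]; congr 1; omega
    simp [G.card_encS, this]
  add_eq := by
    have : 2 * t - 1 = t + (t - 1) := by omega
    rw [this, add_mul, ← add_assoc, ← mul_add, add_comm G.β, G.add_eq]
  rank_lt := by
    have h1 : 2 * t - 1 = (t - 1) + t := by omega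
    have := G.rank_lt
    have : N ≤ t * N := Nat.le_mul_of_pos_left _ ht
    rw [h1, add_mul]
    omega
  encS_mem := fun s a ha => sum_shift_mem (fun i => G.encO_mem (s i)) ha
  encO_mem := by
    intro p a ha
    have hp := G.rank_lt
    obtain ⟨v, hv1, hv2, -⟩ :=
      G.select (Classical.arbitrary _) (Classical.arbitrary _)
    have : 0 < t * w := by
      have : 0 < w := by omega
      positivity
    rw [Multiset.mem_add, Multiset.mem_add] at ha
    rcases ha with ha | ha | ha
    · exact sum_shift_mem (fun i => G.encS_mem (p.2 i)) ha
    · rw [Multiset.eq_of_mem_replicate ha]; omega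
    · rw [Multiset.eq_of_mem_replicate ha]; omega
  select := by
    rintro s ⟨j, y⟩
    obtain ⟨v, hv1, hv2, hv3, hv4, hv5⟩ := G.select (y j) (s j)
    have hj : ((j : ℕ) + 1) * w ≤ t * w := Nat.mul_le_mul_right _ j.2
    rw [add_mul, one_mul] at hj
    refine ⟨v + j * w, by omega, by omega, ?_, ?_⟩
    · simp only
      rw [← hv3, Nat.testBit_zero, Nat.testBit_zero]
      -- The interval length is even, so the shift by `j * w` keeps the parity.
      obtain ⟨e, rfl⟩ := hw
      have : (v + j * (e + e)) % 2 = v % 2 := by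
        rw [← two_mul, mul_left_comm, Nat.add_mul_mod_self_left]
      rw [this]
    · have h := select_shift (fun i => G.encS (y i) + G.encO (s i))
        (fun i a ha => (Multiset.mem_add.1 ha).elim (G.encS_mem _ a) (G.encO_mem _ a))
        (fun i => by rw [Multiset.card_add, G.card_encS, G.card_encO, G.add_eq]) j hv1 hv2 hv4 hv5
      have e : (∑ i, (G.encO (s i)).map (· + i * w)) +
          (∑ i, (G.encS (y i)).map (· + i * w) + (Multiset.replicate ((t - 1 - j) * N) 1 +
            Multiset.replicate (j * N) (t * w))) =
          ∑ i, (G.encS (y i) + G.encO (s i)).map (· + i * w) +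
            (Multiset.replicate ((t - 1 - j) * N) 1 + Multiset.replicate (j * N) (t * w)) := by
        simp only [Multiset.map_add, Finset.sum_add_distrib]
        rw [← add_assoc, add_comm (∑ i, (G.encO (s i)).map (· + i * w))]
      simp only at h ⊢
      rw [e]
      exact h

/-- Each round costs a factor `2t - 1` in the number of values (`t` copies and padding worth `t -
1`) and a factor `t` in their range. -/
theorem exists_hard {W : Type} [Fintype W] (hW : 4 * Fintype.card W ^ 2 * 3 ^ t < 4 ^ t)
    (ht : 0 < t) (d : ℕ) :
    ∃ G : SelectionGame ((2 * t - 1) ^ d) (2 * t ^ d), Hard W d G.f := by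
  induction d with
  | zero => exact ⟨bit, hard_zero W⟩
  | succ d ih =>
    obtain ⟨G, hG⟩ := ih
    have h := hG.succ hW
    rw [pow_succ', pow_succ', mul_left_comm 2]
    exact ⟨G.succ (even_two_mul _) ht, h⟩

end SelectionGame

/-! ### Query sequences that alternate rarely. -/

/-- The sequence `s` consists of `r` blocks that avoid, in turn, `B`, `A`, `B`, …, and of a rest
that avoids both. -/
def Alternates {ι : Type} : ℕ → Finset ι → Finset ι → List ι → Prop
  | 0, A, B, s => ∀ i ∈ s, i ∉ A ∧ i ∉ B
  | r + 1, A, B, s => ∃ s₁ s₂, s = s₁ ++ s₂ ∧ (∀ i ∈ s₁, i ∉ B) ∧ Alternates r B A s₂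

theorem Alternates.mono {ι : Type} {r : ℕ} : ∀ {A B A' B' : Finset ι} {s : List ι}, A' ⊆ A →
    B' ⊆ B → Alternates r A B s → Alternates r A' B' s := by
  induction r with
  | zero => exact fun hA hB h i hi => ⟨fun h' => (h i hi).1 (hA h'), fun h' => (h i hi).2 (hB h')⟩
  | succ r ih =>
    rintro A B A' B' s hA hB ⟨s₁, s₂, hs, h₁, h₂⟩
    exact ⟨s₁, s₂, hs, fun i hi h' => h₁ i hi (hB h'), ih hB hA h₂⟩

theorem alternates_of_forall_notMem {ι : Type} (r : ℕ) {A B : Finset ι} {s : List ι}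
    (h : ∀ i ∈ s, i ∉ A ∧ i ∉ B) : Alternates r A B s := by
  induction r generalizing A B with
  | zero => exact h
  | succ r ih => exact ⟨[], s, rfl, by simp, ih fun i hi => (h i hi).symm⟩

/-- If the elements of `A₀` and `B₀` occur rarely in a sequence, then the sequence alternates rarely
between suitable large subsets `A` and `B`. -/
theorem exists_alternates {ι : Type} [DecidableEq ι] (m : ℕ) : ∀ (A₀ B₀ : Finset ι) (s : List ι),
    Disjoint A₀ B₀ → A₀.Nonempty → B₀.Nonempty →
    (∀ a ∈ A₀, ∀ b ∈ B₀, s.count a + s.count b ≤ m) →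
    ∃ A ⊆ A₀, ∃ B ⊆ B₀, A₀.card ≤ A.card * 2 ^ m ∧ B₀.card ≤ B.card * 2 ^ m ∧
      Alternates (2 * m) A B s := by
  induction m with
  | zero =>
    intro A₀ B₀ s _ ⟨a, ha⟩ ⟨b, hb⟩ hc
    refine ⟨A₀, subset_rfl, B₀, subset_rfl, by simp, by simp, fun i hi => ⟨fun h => ?_, fun h => ?_⟩⟩
    · have := hc i h b hb
      have := List.count_pos_iff.2 hi
      omega
    · have := hc a ha i h
      have := List.count_pos_iff.2 hi
      omega
  | succ m ih =>
    intro A₀ B₀ s hd hA hB hc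
    have hA' := hA.card_pos
    have hB' := hB.card_pos
    have hsplit : ∀ (C : Finset ι) (l : List ι),
        (C.filter (· ∈ l)).card + (C.filter (· ∉ l)).card = C.card := fun C l =>
      Finset.card_filter_add_card_filter_not _
    have hmem : ∀ l₁ l₂ (i : ι), s = l₁ ++ l₂ → s.count i = l₁.count i + l₂.count i := by
      rintro l₁ l₂ i rfl
      exact List.count_append
    -- The prefix is cut at the first moment when it contains half of `A₀` or half of `B₀`. Keeping
    -- the seen half of one set and the unseen half of the other uses up one occurrence in every
    -- pair, so the rest of the sequence falls under the induction hypothesis for `m`.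
    by_cases hP : ∃ L, A₀.card ≤ 2 * (A₀.filter (· ∈ s.take L)).card ∨
        B₀.card ≤ 2 * (B₀.filter (· ∈ s.take L)).card
    · obtain ⟨L, hspec, hmin⟩ : ∃ L, (A₀.card ≤ 2 * (A₀.filter (· ∈ s.take L)).card ∨
          B₀.card ≤ 2 * (B₀.filter (· ∈ s.take L)).card) ∧ ∀ L' < L,
          ¬ (A₀.card ≤ 2 * (A₀.filter (· ∈ s.take L')).card ∨
            B₀.card ≤ 2 * (B₀.filter (· ∈ s.take L')).card) :=
        ⟨Nat.find hP, Nat.find_spec hP, fun _ h => Nat.find_min hP h⟩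
      obtain ⟨L', hL'⟩ : ∃ L', L = L' + 1 := by
        refine Nat.exists_eq_succ_of_ne_zero fun h0 => ?_
        rw [h0] at hspec
        simp only [List.take_zero, List.not_mem_nil, Finset.filter_false, Finset.card_empty] at hspec
        omega
      have hlast := hmin L' (by omega)
      push Not at hlast
      have hs : s = s.take L ++ s.drop L := (List.take_append_drop _ _).symm
      -- The last letter of the prefix belongs to only one of two disjoint sets, so the other set
      -- has still not reached its half.
      have hstep : ∀ C D : Finset ι, Disjoint C D →
          (C.filter (· ∈ s.take L')).card < (C.filter (· ∈ s.take L)).card →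
          D.filter (· ∈ s.take L) = D.filter (· ∈ s.take L') := by
        intro C D hCD hlt
        have hsub : ∀ i, i ∈ s.take L' → i ∈ s.take L := fun i hi =>
          (List.take_subset_take_left s (by omega : L' ≤ L)) hi
        have hex : ∃ c ∈ C, c ∈ s.take L ∧ c ∉ s.take L' := by
          by_contra! h
          refine hlt.not_ge (Finset.card_le_card fun i hi => ?_)
          rw [Finset.mem_filter] at hi ⊢
          exact ⟨hi.1, h i hi.1 hi.2⟩
        obtain ⟨c, hcC, hc1, hc2⟩ := hex
        have htake : ∀ i, i ∈ s.take L → i ∉ s.take L' → s[L']? = some i := by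
          intro i h1 h2
          rw [hL', List.take_add_one, List.mem_append] at h1
          simpa using h1.resolve_left h2
        ext i
        simp only [Finset.mem_filter, and_congr_right_iff]
        refine fun hi => ⟨fun h1 => ?_, hsub i⟩
        by_contra h2
        have := (htake i h1 h2).symm.trans (htake c hc1 hc2)
        rw [Option.some_inj] at this
        subst this
        exact Finset.disjoint_left.1 hCD hcC hi
      have hsplA := hsplit A₀ (s.take L)
      have hsplB := hsplit B₀ (s.take L)
      by_cases hcase : A₀.card ≤ 2 * (A₀.filter (· ∈ s.take L)).card
      · have hB₁ := hstep A₀ B₀ hd (by omega)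
        rw [hB₁] at hsplB
        obtain ⟨A, hAs, B, hBs, h1, h2, h3⟩ := ih (A₀.filter (· ∈ s.take L))
          (B₀.filter (· ∉ s.take L)) (s.drop L)
          (Finset.disjoint_filter_filter hd) (Finset.card_pos.1 (by omega))
          (Finset.card_pos.1 (by omega)) (by
            intro a ha b hb
            rw [Finset.mem_filter] at ha hb
            have := hc a ha.1 b hb.1
            rw [hmem _ _ a hs, hmem _ _ b hs] at this
            have := List.count_pos_iff.2 ha.2
            omega)
        refine ⟨A, hAs.trans (Finset.filter_subset _ _), B, hBs.trans (Finset.filter_subset _ _),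
          by rw [pow_succ, ← mul_assoc]; omega, by rw [pow_succ, ← mul_assoc]; omega, s.take L, s.drop L, hs,
          fun i hi hiB => (Finset.mem_filter.1 (hBs hiB)).2 hi, [], s.drop L, rfl, by simp, h3⟩
      · have hcase' := hspec.resolve_left hcase
        have hA₁ := hstep B₀ A₀ hd.symm (by omega)
        rw [hA₁] at hsplA
        obtain ⟨A, hAs, B, hBs, h1, h2, h3⟩ := ih (A₀.filter (· ∉ s.take L))
          (B₀.filter (· ∈ s.take L)) (s.drop L)
          (Finset.disjoint_filter_filter hd) (Finset.card_pos.1 (by omega))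
          (Finset.card_pos.1 (by omega)) (by
            intro a ha b hb
            rw [Finset.mem_filter] at ha hb
            have := hc a ha.1 b hb.1
            rw [hmem _ _ a hs, hmem _ _ b hs] at this
            have := List.count_pos_iff.2 hb.2
            omega)
        refine ⟨A, hAs.trans (Finset.filter_subset _ _), B, hBs.trans (Finset.filter_subset _ _),
          -- Here the prefix avoids `A`, so an empty block comes first to keep the order of the
          -- players.
          by rw [pow_succ, ← mul_assoc]; omega, by rw [pow_succ, ← mul_assoc]; omega, [], s, rfl, by simp,
          s.take L, s.drop L, hs,
          fun i hi hiA => (Finset.mem_filter.1 (hAs hiA)).2 hi, h3⟩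
    -- Without such a prefix more than half of each set never occurs.
    · push Not at hP
      obtain ⟨h1, h2⟩ := hP s.length
      rw [List.take_length] at h1 h2
      have hsplA := hsplit A₀ s
      have hsplB := hsplit B₀ s
      have hpow : 2 ≤ 2 ^ (m + 1) := by
        rw [pow_succ]
        have := Nat.one_le_two_pow (n := m)
        omega
      refine ⟨A₀.filter (· ∉ s), Finset.filter_subset _ _, B₀.filter (· ∉ s),
        Finset.filter_subset _ _, ?_, ?_, alternates_of_forall_notMem _ fun i hi =>
          ⟨fun h => (Finset.mem_filter.1 h).2 hi, fun h => (Finset.mem_filter.1 h).2 hi⟩⟩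
      · have := Nat.mul_le_mul_left (A₀.filter (· ∉ s)).card hpow
        omega
      · have := Nat.mul_le_mul_left (B₀.filter (· ∉ s)).card hpow
        omega

/-- If the sequence is short then few elements occur often. -/
theorem card_frequent_mul_le {ι : Type} [DecidableEq ι] [Fintype ι] (s : List ι) (p : ℕ) :
    (Finset.univ.filter (p < s.count ·)).card * (p + 1) ≤ s.length := by
  have h1 : s.length = ∑ i, s.count i := by
    have := Multiset.sum_count_eq_card (s := Finset.univ) (m := (s : Multiset ι)) (by simp)
    simpa using this.symm
  rw [h1, ← smul_eq_mul]
  exact (Finset.card_nsmul_le_sum _ _ _ fun i hi => (Finset.mem_filter.1 hi).2).trans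
    (Finset.sum_le_sum_of_subset (Finset.filter_subset _ _))

/-- Two disjoint large sets between which a given short sequence alternates rarely. -/
theorem exists_alternates_of_length {ι : Type} [DecidableEq ι] [Fintype ι] (s : List ι) (p : ℕ)
    (hcard : 8 ≤ Fintype.card ι) (hs : 2 * s.length < Fintype.card ι * (p + 1)) :
    ∃ A B : Finset ι, Disjoint A B ∧ Fintype.card ι ≤ 8 * A.card * 2 ^ (2 * p) ∧
      Fintype.card ι ≤ 8 * B.card * 2 ^ (2 * p) ∧ Alternates (2 * (2 * p)) A B s := by
  have h1 := card_frequent_mul_le s p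
  have h2 : (Finset.univ.filter (p < s.count ·)).card +
      (Finset.univ.filter (¬ p < s.count ·)).card = Fintype.card ι :=
    Finset.card_filter_add_card_filter_not _
  set G := Finset.univ.filter (¬ p < s.count ·) with hG
  have h3 : 2 * (Finset.univ.filter (p < s.count ·)).card < Fintype.card ι := by
    refine Nat.lt_of_mul_lt_mul_right (a := p + 1) ?_
    rw [mul_assoc]
    omega
  -- The factor 8 pays for discarding the frequent indices, splitting the others in two, and
  -- rounding.
  obtain ⟨A₀, hA₀, hA₀c⟩ := Finset.exists_subset_card_eq (s := G) (n := G.card / 2) (by omega)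
  have hB₀c : (G \ A₀).card = G.card - G.card / 2 := by
    rw [Finset.card_sdiff_of_subset hA₀, hA₀c]
  obtain ⟨A, hA, B, hB, hAc, hBc, h⟩ := exists_alternates (2 * p) A₀ (G \ A₀) s
    Finset.disjoint_sdiff (Finset.card_pos.1 (by omega)) (Finset.card_pos.1 (by omega)) (by
      intro a ha b hb
      have ha := (Finset.mem_filter.1 (hA₀ ha)).2
      have hb := (Finset.mem_filter.1 (Finset.sdiff_subset hb)).2
      omega)
  refine ⟨A, B, Finset.disjoint_of_subset_left hA (Finset.disjoint_of_subset_right hB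
    Finset.disjoint_sdiff), ?_, ?_, h⟩
  · rw [mul_assoc]; omega
  · rw [mul_assoc]; omega

/-! ### From programs for the median to protocols. -/

/-- In the sorted tuple the entries below `v`, and those at most `v`, form initial segments, whose
lengths are compared with the position `n / 2`. Both bounds access the median only through these
counts. -/
theorem median_eq_iff {n : ℕ} (hn : 0 < n) (x : Fin n → InputValue n) (v : InputValue n) :
    median hn x = v ↔ (Finset.univ.filter (x · < v)).card ≤ n / 2 ∧
      n / 2 < (Finset.univ.filter (x · ≤ v)).card := by
  set j : Fin n := ⟨n / 2, Nat.div_lt_self hn one_lt_two⟩ with hj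
  have hmono : Monotone (x ∘ Tuple.sort x) := Tuple.monotone_sort x
  have hle : (j : ℕ) < (Finset.univ.filter (x · ≤ v)).card ↔ (x ∘ Tuple.sort x) j ≤ v := by
    rw [← Finset.card_equiv (s := Finset.univ.filter ((x ∘ Tuple.sort x) · ≤ v)) (Tuple.sort x)
      (by simp)]
    exact Tuple.lt_card_le_iff_apply_le_of_monotone (j := j) (a := v) hmono
  have hlt : (j : ℕ) < (Finset.univ.filter (x · < v)).card ↔ (x ∘ Tuple.sort x) j < v := by
    rw [← Finset.card_equiv (s := Finset.univ.filter ((x ∘ Tuple.sort x) · < v)) (Tuple.sort x)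
      (by simp)]
    exact Tuple.lt_card_lt_iff_apply_lt_of_monotone (j := j) (a := v) hmono
  rw [show n / 2 = (j : ℕ) from rfl, ← not_lt, hlt, hle, not_lt,
    show median hn x = (x ∘ Tuple.sort x) j from rfl]
  exact ⟨fun h => ⟨h.ge, h.le⟩, fun h => le_antisymm h.2 h.1⟩

theorem medianBit_eq {n : ℕ} (hn : 0 < n) (x : Fin n → InputValue n) :
    medianBit n x = ((median hn x : InputValue n) : ℕ).testBit 0 := by
  rw [medianBit, dif_pos hn]

theorem Finset.exists_val_map_eq {ι γ : Type} [Nonempty γ] [DecidableEq ι] (A : Finset ι) :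
    ∀ m : Multiset γ, m.card = A.card → ∃ g : ι → γ, A.val.map g = m := by
  induction A using Finset.induction_on with
  | empty =>
    intro m hm
    exact ⟨fun _ => Classical.arbitrary γ, by simpa [eq_comm] using hm⟩
  | insert a A ha ih =>
    intro m hm
    rw [Finset.card_insert_of_notMem ha] at hm
    obtain ⟨c, hc⟩ := Multiset.card_pos_iff_exists_mem.1 (show 0 < m.card by omega)
    obtain ⟨m', rfl⟩ := Multiset.exists_cons_of_mem hc
    obtain ⟨g, rfl⟩ := ih m' (by rwa [Multiset.card_cons, Nat.add_right_cancel_iff] at hm)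
    refine ⟨Function.update g a c, ?_⟩
    rw [Finset.insert_val_of_notMem ha, Multiset.map_cons, Function.update_self]
    congr 1
    refine Multiset.map_congr rfl fun i hi => Function.update_of_ne ?_ _ _
    rintro rfl
    exact ha hi

theorem Finset.countP_val_map {ι γ : Type} (A : Finset ι) (g : ι → γ) (p : γ → Prop)
    [DecidablePred p] : (A.val.map g).countP p = (A.filter fun i => p (g i)).card := by
  rw [Multiset.countP_map]
  rfl

/-- A machine whose queries alternate rarely between `A` and `B` gives a short protocol for the
owners of the values on `A` and on `B`. -/
theorem Alternates.solvable {V D : Type} {n : ℕ} (nx : V → D → V) (out : V → Bool) (r : ℕ) :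
    ∀ {X Y : Type} [Nonempty X] [Nonempty Y] {A B : Finset (Fin n)} {s : List (Fin n)}
      (E : X → Y → Fin n → D) (f : X → Y → Bool) (X' : Set X) (Y' : Set Y) (v : V),
      Alternates r A B s → (∀ x y y' i, i ∉ B → E x y i = E x y' i) →
      (∀ x x' y i, i ∉ A → E x y i = E x' y i) →
      (∀ x ∈ X', ∀ y ∈ Y', f x y = out (s.foldl (fun u i => nx u (E x y i)) v)) →
      Solvable V r X' Y' f := by
  induction r with
  | zero =>
    intro X Y _ _ A B s E f X' Y' v hs hX hY hf
    -- The remaining queries avoid both sets, so neither input affects the result.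
    refine ⟨out (s.foldl (fun u i => nx u (E (Classical.arbitrary X) (Classical.arbitrary Y) i)) v),
      fun x hx y hy => ?_⟩
    rw [hf x hx y hy]
    congr 1
    refine List.foldl_ext _ _ _ fun u i hi => ?_
    rw [hX x y (Classical.arbitrary Y) i (hs i hi).2, hY x (Classical.arbitrary X) _ i (hs i hi).1]
  | succ r ih =>
    rintro X Y _ _ A B s E f X' Y' v ⟨s₁, s₂, rfl, h₁, h₂⟩ hX hY hf
    -- The message is the node reached after `s₁`. That block avoids `B`, so the speaker may
    -- simulate it with any input of the partner.
    refine ⟨fun x => s₁.foldl (fun u i => nx u (E x (Classical.arbitrary Y) i)) v, fun w =>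
      ih (fun y x => E x y) _ _ _ w h₂ (fun y x x' i hi => hY x x' y i hi)
        (fun y y' x i hi => hX x y y' i hi) ?_⟩
    rintro y hy x ⟨hx, rfl⟩
    rw [hf x hx y hy, List.foldl_append]
    congr 2
    refine List.foldl_ext _ _ _ fun u i hi => ?_
    rw [hX x y _ i (h₁ i hi)]

namespace BranchingProgram

variable {n : ℕ} {D R : Type}

open Classical in
/-- The node reached from the node `u` by an edge labelled `d`, if there is one. -/
noncomputable def next (B : BranchingProgram n D R) (u : B.V) (d : D) : B.V :=
  if h : ∃ v, B.Edge u d v then h.choose else u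

theorem IsDeterministic.next_eq {B : BranchingProgram n D R} (hB : B.IsDeterministic) {u v : B.V}
    {d : D} (h : B.Edge u d v) : B.next u d = v := by
  have hex : ∃ v, B.Edge u d v := ⟨v, h⟩
  rw [next, dif_pos hex]
  rcases hu : B.label u with i | r
  · exact (hB u i hu d).unique hex.choose_spec h
  · exact absurd h (B.sink_no_edge u r d v hu)

theorem IsDeterministic.exists_isPath {B : BranchingProgram n D R} (hB : B.IsDeterministic)
    {x : Fin n → D} {u v : B.V}
    (h : Relation.ReflTransGen (fun a b => ∃ i, B.label a = Sum.inl i ∧ B.Edge a (x i) b) u v) :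
    ∃ s, B.IsPath u s v ∧ s.foldl (fun u i => B.next u (x i)) u = v := by
  induction h using Relation.ReflTransGen.head_induction_on with
  | refl => exact ⟨[], .nil v, rfl⟩
  | head h _ ih =>
    obtain ⟨i, hi, he⟩ := h
    obtain ⟨s, hs, hs'⟩ := ih
    exact ⟨i :: s, .cons hi he hs, by rw [List.foldl_cons, hB.next_eq he, hs']⟩

/-- A deterministic oblivious program processes its query sequence. -/
theorem exists_seq_label_eq [Nonempty D] {B : BranchingProgram n D R} (hB : B.IsDeterministic)
    (hO : B.IsOblivious) {f : (Fin n → D) → R} (hf : B.Computes f) :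
    ∃ s, B.IsSourceSinkSeq s ∧
      ∀ x, B.label (s.foldl (fun u i => B.next u (x i)) B.source) = Sum.inr (f x) := by
  have h : ∀ x, ∃ s, B.IsSourceSinkSeq s ∧
      B.label (s.foldl (fun u i => B.next u (x i)) B.source) = Sum.inr (f x) := by
    intro x
    obtain ⟨⟨v, hv, hl⟩, -⟩ := hf x
    obtain ⟨s, hs, rfl⟩ := hB.exists_isPath hv
    exact ⟨s, ⟨_, _, hl, hs⟩, hl⟩
  obtain ⟨s, hs, -⟩ := h fun _ => Classical.arbitrary D
  refine ⟨s, hs, fun x => ?_⟩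
  obtain ⟨t, ht, hx⟩ := h x
  rwa [hO s t hs ht]

end BranchingProgram

/-- The number `a` as an input value (`1` if it is none). -/
def toInputValue {n : ℕ} (hn : 0 < n) (a : ℕ) : InputValue n :=
  if h : 1 ≤ a ∧ a ≤ 2 * n then ⟨a, Finset.mem_Icc.2 h⟩ else ⟨1, Finset.mem_Icc.2 ⟨le_rfl, by omega⟩⟩

theorem coe_toInputValue {n : ℕ} (hn : 0 < n) {a : ℕ} (h : 1 ≤ a ∧ a ≤ 2 * n) :
    (toInputValue hn a : ℕ) = a := by
  rw [toInputValue, dif_pos h]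

/-- A selection game with few small numbers is contained in the median problem. -/
theorem SelectionGame.exists_embedding {N w n : ℕ} (G : SelectionGame N w) (hn : 0 < n)
    (hw : w ≤ 2 * n) {A B : Finset (Fin n)} (hAB : Disjoint A B) (hA : A.card = G.α)
    (hB : B.card = G.β) (hN : 2 * N ≤ n) :
    ∃ E : G.S → G.O → Fin n → InputValue n,
      (∀ x y y' i, i ∉ B → E x y i = E x y' i) ∧ (∀ x x' y i, i ∉ A → E x y i = E x' y i) ∧
      ∀ x y, medianBit n (E x y) = G.f x y := by
  classical
  have hρ := G.rank_lt
  have hαβ := G.add_eq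
  have hUc : (A ∪ B).card = N := by rw [Finset.card_union_of_disjoint hAB, hA, hB, hαβ]
  -- Placing 1 on `n / 2 - ρ` spare cells and `2n` on the others turns rank `ρ` of the game into
  -- rank `n / 2`; `2N ≤ n` leaves enough cells.
  obtain ⟨L, hL, hLc⟩ := Finset.exists_subset_card_eq (s := (A ∪ B)ᶜ) (n := n / 2 - G.ρ) (by
    rw [Finset.card_compl, Fintype.card_fin, hUc]; omega)
  have hLd : Disjoint (A ∪ B) L :=
    Finset.disjoint_of_subset_right hL disjoint_compl_right
  choose gA hgA using fun x => A.exists_val_map_eq (G.encS x) (by rw [G.card_encS, hA])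
  choose gB hgB using fun y => B.exists_val_map_eq (G.encO y) (by rw [G.card_encO, hB])
  let e : G.S → G.O → Fin n → ℕ := fun x y i =>
    if i ∈ A then gA x i else if i ∈ B then gB y i else if i ∈ L then 1 else 2 * n
  have heA : ∀ x y i, i ∈ A → e x y i = gA x i := fun x y i hi => if_pos hi
  have heB : ∀ x y i, i ∈ B → e x y i = gB y i := fun x y i hi => by
    simp only [e]
    rw [if_neg (Finset.disjoint_right.1 hAB hi), if_pos hi]
  have heU : ∀ x y i, i ∉ A ∪ B → e x y i = if i ∈ L then 1 else 2 * n := fun x y i hi => by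
    rw [Finset.mem_union, not_or] at hi
    simp only [e]
    rw [if_neg hi.1, if_neg hi.2]
  have heL : ∀ x y i, i ∈ L → e x y i = 1 := fun x y i hi => by
    rw [heU x y i (Finset.disjoint_right.1 hLd hi), if_pos hi]
  have he : ∀ x y i, 1 ≤ e x y i ∧ e x y i ≤ 2 * n := by
    intro x y i
    by_cases hiA : i ∈ A
    · rw [heA x y i hiA]
      have := G.encS_mem x (gA x i) (by rw [← hgA x]; exact Multiset.mem_map_of_mem _ hiA)
      omega
    · by_cases hiB : i ∈ B
      · rw [heB x y i hiB]
        have := G.encO_mem y (gB y i) (by rw [← hgB y]; exact Multiset.mem_map_of_mem _ hiB)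
        omega
      · rw [heU x y i (by simp [hiA, hiB])]
        split_ifs <;> omega
  refine ⟨fun x y i => toInputValue hn (e x y i), ?_, ?_, ?_⟩
  · intro x y y' i hi
    simp only [e, hi, if_false]
  · intro x x' y i hi
    simp only [e, hi, if_false]
  · intro x y
    obtain ⟨v, hv1, hv2, hv3, hv4, hv5⟩ := G.select x y
    rw [Multiset.countP_add, ← hgA, ← hgB, Finset.countP_val_map, Finset.countP_val_map] at hv4 hv5
    have hv : 1 ≤ v ∧ v ≤ 2 * n := ⟨hv1, hv2.trans hw⟩
    rw [medianBit_eq hn, (median_eq_iff hn _ (toInputValue hn v)).2, coe_toInputValue hn hv, hv3]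
    constructor
    · change (Finset.univ.filter fun i => toInputValue hn (e x y i) < toInputValue hn v).card ≤ n / 2
      have hsub : (Finset.univ.filter fun i => toInputValue hn (e x y i) < toInputValue hn v) ⊆
          (A.filter fun i => gA x i < v) ∪ (B.filter fun i => gB y i < v) ∪ L := by
        intro i hi
        rw [Finset.mem_filter, ← Subtype.coe_lt_coe, coe_toInputValue hn hv,
          coe_toInputValue hn (he x y i)] at hi
        simp only [Finset.mem_union, Finset.mem_filter]
        by_contra! h
        by_cases hiA : i ∈ A
        · have := h.1.1 hiA
          rw [heA x y i hiA] at hi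
          omega
        · by_cases hiB : i ∈ B
          · have := h.1.2 hiB
            rw [heB x y i hiB] at hi
            omega
          · rw [heU x y i (by simp [hiA, hiB]), if_neg h.2] at hi
            omega
      have h1 := Finset.card_le_card hsub
      have h2 := Finset.card_union_le ((A.filter fun i => gA x i < v) ∪
        (B.filter fun i => gB y i < v)) L
      have h3 := Finset.card_union_le (A.filter fun i => gA x i < v) (B.filter fun i => gB y i < v)
      omega
    · change n / 2 < (Finset.univ.filter fun i => toInputValue hn (e x y i) ≤ toInputValue hn v).card
      have hsub : (A.filter fun i => gA x i ≤ v) ∪ (B.filter fun i => gB y i ≤ v) ∪ L ⊆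
          (Finset.univ.filter fun i => toInputValue hn (e x y i) ≤ toInputValue hn v) := by
        intro i hi
        rw [Finset.mem_filter, ← Subtype.coe_le_coe, coe_toInputValue hn hv,
          coe_toInputValue hn (he x y i)]
        simp only [Finset.mem_union, Finset.mem_filter] at hi
        refine ⟨Finset.mem_univ _, ?_⟩
        rcases hi with (hi | hi) | hi
        · rw [heA x y i hi.1]; exact hi.2
        · rw [heB x y i hi.1]; exact hi.2
        · rw [heL x y i hi]; exact hv1
      have h1 := Finset.card_le_card hsub
      rw [Finset.card_union_of_disjoint, Finset.card_union_of_disjoint] at h1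
      · omega
      · exact Finset.disjoint_filter_filter hAB
      · exact Finset.disjoint_of_subset_left
          (Finset.union_subset_union (Finset.filter_subset _ _) (Finset.filter_subset _ _)) hLd

instance BranchingProgram.instFintypeV {n : ℕ} {D R : Type} (B : BranchingProgram n D R) :
    Fintype B.V := B.fintypeV

theorem nonempty_inputValue {n : ℕ} (hn : 0 < n) : Nonempty (InputValue n) := ⟨toInputValue hn 1⟩

/-! ### Size lower bounds. -/

/-- The combinatorial form of the size lower bound. -/
theorem four_pow_le_size {n T p t : ℕ} {B : BranchingProgram n (InputValue n) Bool}
    (hB : B.IsDeterministic) (hO : B.IsOblivious) (hT : B.LengthLE T)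
    (hf : B.Computes (medianBit n)) (hp : 2 * T < n * (p + 1)) (ht : 0 < t)
    (hn : 8 * (4 * t) ^ (4 * p) ≤ n) : 4 ^ t ≤ 4 * B.size ^ 2 * 3 ^ t := by
  by_contra! hW
  change 4 * Fintype.card B.V ^ 2 * 3 ^ t < 4 ^ t at hW
  have h1 : 1 ≤ (4 * t) ^ (4 * p) := Nat.one_le_pow _ _ (by omega)
  have hn0 : 0 < n := by omega
  have := nonempty_inputValue hn0
  obtain ⟨s, hs, hl⟩ := BranchingProgram.exists_seq_label_eq hB hO hf
  obtain ⟨A, C, hAC, hA, hC, halt⟩ := exists_alternates_of_length s p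
    (by rw [Fintype.card_fin]; omega) (by rw [Fintype.card_fin]; have := hT s hs; omega)
  rw [Fintype.card_fin] at hA hC
  obtain ⟨G, hG⟩ := SelectionGame.exists_hard hW ht (2 * (2 * p))
  have hr : 2 * (2 * p) = 4 * p := by ring
  have hN : (2 * t - 1) ^ (2 * (2 * p)) * 2 ^ (2 * p) ≤ (4 * t) ^ (4 * p) := by
    have e : 4 * t = (2 * t) * 2 := by ring
    rw [e, mul_pow, hr]
    exact Nat.mul_le_mul (Nat.pow_le_pow_left (by omega) _)
      (Nat.pow_le_pow_right two_pos (by omega))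
  have hNA : (2 * t - 1) ^ (2 * (2 * p)) ≤ A.card :=
    Nat.le_of_mul_le_mul_right (c := 2 ^ (2 * p)) (by rw [mul_assoc] at hA; omega) (by positivity)
  have hNC : (2 * t - 1) ^ (2 * (2 * p)) ≤ C.card :=
    Nat.le_of_mul_le_mul_right (c := 2 ^ (2 * p)) (by rw [mul_assoc] at hC; omega) (by positivity)
  have hαβ := G.add_eq
  obtain ⟨A₁, hA₁, hA₁c⟩ := Finset.exists_subset_card_eq (s := A) (n := G.α) (by omega)
  obtain ⟨C₁, hC₁, hC₁c⟩ := Finset.exists_subset_card_eq (s := C) (n := G.β) (by omega)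
  have hcard : A.card + C.card ≤ n := by
    rw [← Finset.card_union_of_disjoint hAC]
    simpa using Finset.card_le_univ (A ∪ C)
  have hw : 2 * t ^ (2 * (2 * p)) ≤ 2 * n := by
    have : t ^ (4 * p) ≤ (4 * t) ^ (4 * p) := Nat.pow_le_pow_left (by omega) _
    rw [hr]; omega
  obtain ⟨E, hE1, hE2, hE3⟩ := G.exists_embedding hn0 hw
    (Finset.disjoint_of_subset_left hA₁ (Finset.disjoint_of_subset_right hC₁ hAC)) hA₁c hC₁c
    (by omega)
  refine hG Finset.univ Finset.univ (by rw [Finset.card_univ]; omega)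
    (by rw [Finset.card_univ]; omega) ?_
  refine Alternates.solvable B.next (fun u => (B.label u).elim (fun _ => false) id) _ E _ _ _
    B.source (halt.mono hA₁ hC₁) hE1 hE2 fun x _ y _ => ?_
  rw [hl, hE3]
  rfl

/-- A program for the median reads all its inputs. -/
theorem le_length_of_computes_medianBit {n T : ℕ} {B : BranchingProgram n (InputValue n) Bool}
    (hn : 2 ≤ n) (hB : B.IsDeterministic) (hO : B.IsOblivious) (hT : B.LengthLE T)
    (hf : B.Computes (medianBit n)) : n ≤ T := by
  classical
  have hn0 : 0 < n := by omega
  have := nonempty_inputValue hn0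
  obtain ⟨s, hs, hl⟩ := BranchingProgram.exists_seq_label_eq hB hO hf
  refine le_trans ?_ (hT s hs)
  by_contra! hlen
  obtain ⟨i, hi⟩ : ∃ i, i ∉ s := by
    by_contra! h
    have h1 : (Finset.univ : Finset (Fin n)).card ≤ s.toFinset.card :=
      Finset.card_le_card fun i _ => by simpa using h i
    have h2 := s.toFinset_card_le
    rw [Finset.card_univ, Fintype.card_fin] at h1
    omega
  obtain ⟨L, hL, hLc⟩ := Finset.exists_subset_card_eq (s := Finset.univ.erase i) (n := n / 2) (by
    rw [Finset.card_erase_of_mem (Finset.mem_univ _), Finset.card_univ, Fintype.card_fin]; omega)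
  have hiL : i ∉ L := fun h => Finset.notMem_erase i _ (hL h)
  -- With `n / 2` ones, `v` at the unread index and `2n` elsewhere, the median is `v`; the values 2
  -- and 3 differ in parity.
  let x : ℕ → Fin n → InputValue n := fun v j =>
    if j ∈ L then toInputValue hn0 1 else if j = i then toInputValue hn0 v else
      toInputValue hn0 (2 * n)
  have hmed : ∀ v, 2 ≤ v → v < 2 * n → medianBit n (x v) = v.testBit 0 := by
    intro v hv hv'
    have hvv : (toInputValue hn0 v : ℕ) = v := coe_toInputValue hn0 (by omega)
    have h1v : (toInputValue hn0 1 : ℕ) = 1 := coe_toInputValue hn0 (by omega)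
    have htv : (toInputValue hn0 (2 * n) : ℕ) = 2 * n := coe_toInputValue hn0 (by omega)
    rw [medianBit_eq hn0, (median_eq_iff hn0 _ (toInputValue hn0 v)).2, hvv]
    constructor
    · rw [← hLc]
      refine Finset.card_le_card fun j hj => ?_
      rw [Finset.mem_filter] at hj
      by_contra hjL
      have hj := hj.2
      simp only [x] at hj
      rw [if_neg hjL] at hj
      split_ifs at hj
      · exact lt_irrefl _ hj
      · rw [← Subtype.coe_lt_coe, hvv, htv] at hj
        omega
    · have h1 : (insert i L).card = n / 2 + 1 := by rw [Finset.card_insert_of_notMem hiL, hLc]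
      refine Nat.lt_of_succ_le (h1.symm.le.trans (Finset.card_le_card fun j hj => ?_))
      rw [Finset.mem_filter]
      refine ⟨Finset.mem_univ _, ?_⟩
      rcases Finset.mem_insert.1 hj with rfl | hj
      · simp only [x]
        rw [if_neg hiL]
        simp
      · simp only [x]
        rw [if_pos hj, ← Subtype.coe_le_coe, hvv, h1v]
        omega
  have heq : medianBit n (x 2) = medianBit n (x 3) := by
    have h2 := hl (x 2)
    rw [List.foldl_ext (g := fun u i => B.next u (x 3 i)), hl (x 3)] at h2
    · exact (Sum.inr.inj h2).symm
    · intro u j hj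
      have : j ≠ i := fun h => hi (h ▸ hj)
      simp only [x, if_neg this]
  rw [hmed 2 le_rfl (by omega), hmed 3 (by omega) (by omega)] at heq
  simp at heq

/-- The constant inputs 1 and 2 need different sinks. This settles the case `t = 0` and absorbs
constant factors in `two_rpow_le_size`. -/
theorem two_le_size {n : ℕ} {B : BranchingProgram n (InputValue n) Bool} (hn : 0 < n)
    (hB : B.IsDeterministic) (hO : B.IsOblivious) (hf : B.Computes (medianBit n)) :
    2 ≤ B.size := by
  have := nonempty_inputValue hn
  obtain ⟨s, -, hl⟩ := BranchingProgram.exists_seq_label_eq hB hO hf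
  by_contra! h
  have hsub : Subsingleton B.V := Fintype.card_le_one_iff_subsingleton.1 (Nat.le_of_lt_succ h)
  have hconst : ∀ v : ℕ, 1 ≤ v → v ≤ 2 * n →
      B.label B.source = Sum.inr (v.testBit 0) := by
    intro v hv hv'
    rw [← coe_toInputValue hn ⟨hv, hv'⟩, Subsingleton.elim B.source
      (s.foldl (fun u _ => B.next u (toInputValue hn v)) B.source)]
    refine (hl fun _ => toInputValue hn v).trans ?_
    rw [medianBit_eq hn]
    rfl
  have h1 := (hconst 1 le_rfl (by omega)).symm.trans (hconst 2 (by omega) (by omega))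
  simp at h1

/-- The argument yields the exponent `1 / (4p)` with `4p ≤ 8k`; this comparison weakens it to the
stated one. -/
theorem two_mul_le_two_rpow {k : ℝ} : 8 * k ≤ (2 : ℝ) ^ (4 * k + 2) := by
  have h1 : (2 : ℝ) ^ (4 * k + 2) = 4 * Real.exp (Real.log 2 * (4 * k)) := by
    rw [Real.rpow_add two_pos, Real.rpow_def_of_pos two_pos (4 * k)]
    norm_num
    ring
  rcases le_total k 0 with hk | hk
  · have : 0 < (2 : ℝ) ^ (4 * k + 2) := by positivity
    linarith
  · have h2 := Real.add_one_le_exp (Real.log 2 * (4 * k))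
    have h3 : (1 / 2 : ℝ) ≤ Real.log 2 := by have := Real.log_two_gt_d9; linarith
    have h4 : (1 / 2 : ℝ) * (4 * k) ≤ Real.log 2 * (4 * k) := by gcongr
    rw [h1]
    linarith

/-- The size lower bound for the median, in terms of the length. -/
theorem two_rpow_le_size {k : ℝ} {n T : ℕ} {B : BranchingProgram n (InputValue n) Bool}
    (hn : 2 ≤ n) (hk : (T : ℝ) ≤ k * n) (hB : B.IsDeterministic) (hO : B.IsOblivious)
    (hT : B.LengthLE T) (hf : B.Computes (medianBit n)) :
    (2 : ℝ) ^ ((n : ℝ) ^ (1 / (2 : ℝ) ^ (4 * k + 2)) / 768) ≤ B.size := by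
  have hn0 : (0 : ℝ) < n := by exact_mod_cast (by omega : 0 < n)
  have hn1 : (1 : ℝ) ≤ n := by exact_mod_cast (by omega : 1 ≤ n)
  have hnT : (n : ℝ) ≤ T := by exact_mod_cast le_length_of_computes_medianBit hn hB hO hT hf
  have hk1 : 1 ≤ k := by
    by_contra! h
    have : k * n < 1 * n := by gcongr
    linarith
  set p := ⌊2 * k⌋₊ with hp
  have hp1 : (p : ℝ) ≤ 2 * k := Nat.floor_le (by linarith)
  have hp2 : 2 * k < p + 1 := Nat.lt_floor_add_one _
  have hp0 : 1 ≤ p := Nat.le_floor (by push_cast; linarith)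
  have hTp : 2 * T < n * (p + 1) := by
    have : (2 : ℝ) * T < n * (p + 1) := by nlinarith
    exact_mod_cast this
  set y : ℝ := (n : ℝ) ^ (1 / (4 * p : ℕ) : ℝ) with hy
  have hy0 : 0 ≤ y := by positivity
  have hyp : y ^ (4 * p) = n := by
    rw [hy, one_div, Real.rpow_inv_natCast_pow hn0.le (by omega)]
  have hey : (n : ℝ) ^ (1 / (2 : ℝ) ^ (4 * k + 2)) ≤ y := by
    refine Real.rpow_le_rpow_of_exponent_le hn1 (one_div_le_one_div_of_le ?_ ?_)
    · exact_mod_cast (by omega : 0 < 4 * p)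
    · have := two_mul_le_two_rpow (k := k)
      push_cast
      linarith
  -- Then `4t ≤ y / 8`, and the gain `8 ^ (4p)` pays for the factor 8 in `hcond`. Since `y < 32(t +
  -- 1) ≤ 64t` when `t ≥ 1`, the constant `768 = 64 * 12` leaves the exponent `t / 12`.
  set t := ⌊y / 32⌋₊ with ht
  have ht1 : (t : ℝ) ≤ y / 32 := Nat.floor_le (by positivity)
  have ht2 : y / 32 < t + 1 := Nat.lt_floor_add_one _
  have hM := two_le_size (by omega) hB hO hf
  rcases Nat.eq_zero_or_pos t with ht0 | ht0
  · rw [ht0, Nat.cast_zero] at ht2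
    calc (2 : ℝ) ^ ((n : ℝ) ^ (1 / (2 : ℝ) ^ (4 * k + 2)) / 768) ≤ 2 ^ (1 : ℝ) :=
          Real.rpow_le_rpow_of_exponent_le one_le_two (by linarith)
      _ ≤ B.size := by rw [Real.rpow_one]; exact_mod_cast hM
  · have hcond : 8 * (4 * t) ^ (4 * p) ≤ n := by
      have h1 : (4 * t : ℝ) ^ (4 * p) ≤ (y / 8) ^ (4 * p) := by
        gcongr
        linarith
      have h2 : (8 : ℝ) ≤ 8 ^ (4 * p) := le_self_pow₀ (by norm_num) (by omega)
      have h3 : (8 : ℝ) * (4 * t) ^ (4 * p) ≤ n := by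
        calc (8 : ℝ) * (4 * t) ^ (4 * p) ≤ 8 ^ (4 * p) * (y / 8) ^ (4 * p) := by gcongr
          _ = n := by rw [← mul_pow, mul_div_cancel₀ _ (by norm_num), hyp]
      exact_mod_cast h3
    have h1 := four_pow_le_size hB hO hT hf hTp ht0 hcond
    -- Cubing uses `(4/3)^3 > 2`.
    have h2 : 2 ^ t ≤ B.size ^ 12 := by
      have h3 : 2 ^ t * 27 ^ t ≤ 64 * B.size ^ 6 * 27 ^ t := by
        calc 2 ^ t * 27 ^ t ≤ 64 ^ t := by rw [← mul_pow]; gcongr; norm_num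
          _ = (4 ^ t) ^ 3 := by rw [← pow_mul, mul_comm t, pow_mul]; norm_num
          _ ≤ (4 * B.size ^ 2 * 3 ^ t) ^ 3 := by gcongr
          _ = 64 * B.size ^ 6 * (3 ^ 3) ^ t := by rw [← pow_mul 3 3, mul_comm 3 t, pow_mul]; ring
          _ = _ := by norm_num
      calc 2 ^ t ≤ 2 ^ 6 * B.size ^ 6 := Nat.le_of_mul_le_mul_right h3 (by positivity)
        _ ≤ B.size ^ 6 * B.size ^ 6 := by gcongr
        _ = B.size ^ 12 := by ring
    have h3 : (2 : ℝ) ^ (t : ℝ) ≤ (B.size : ℝ) ^ 12 := by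
      rw [Real.rpow_natCast]
      exact_mod_cast h2
    have ht0' : (1 : ℝ) ≤ t := by exact_mod_cast ht0
    calc (2 : ℝ) ^ ((n : ℝ) ^ (1 / (2 : ℝ) ^ (4 * k + 2)) / 768) ≤ 2 ^ ((t : ℝ) * (1 / 12)) :=
          Real.rpow_le_rpow_of_exponent_le one_le_two (by linarith)
      _ = (2 ^ (t : ℝ)) ^ (1 / 12 : ℝ) := Real.rpow_mul two_pos.le _ _
      _ ≤ ((B.size : ℝ) ^ 12) ^ (1 / 12 : ℝ) := by gcongr
      _ = B.size := by
        rw [← Real.rpow_natCast, ← Real.rpow_mul (Nat.cast_nonneg _)]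
        norm_num

theorem exists_two_rpow_div_log_le_size : ∃ c C : ℝ, 0 < c ∧ 0 < C ∧ ∀ (k : ℝ) (n T : ℕ), 2 ≤ n →
    (T : ℝ) ≤ k * n → ∀ B : BranchingProgram n (InputValue n) Bool,
      B.IsDeterministic → B.IsOblivious → B.LengthLE T → B.Computes (medianBit n) →
        (2 : ℝ) ^ (c * (n : ℝ) ^ (1 / (2 : ℝ) ^ (4 * k + 2)) / Real.log n ^ C) ≤ B.size := by
  -- For `n ≥ 2` the logarithm is at least 1/2, so dividing by it costs at most a factor 2.
  refine ⟨1 / 1536, 1, by norm_num, one_pos, fun k n T hn hk B hB hO hT hf => ?_⟩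
  refine le_trans (Real.rpow_le_rpow_of_exponent_le one_le_two ?_)
    (two_rpow_le_size hn hk hB hO hT hf)
  have h1 : (1 / 2 : ℝ) ≤ Real.log n := by
    have h2 : Real.log 2 ≤ Real.log n := Real.log_le_log two_pos (by exact_mod_cast hn)
    have := Real.log_two_gt_d9
    linarith
  have h0 : 0 ≤ (n : ℝ) ^ (1 / (2 : ℝ) ^ (4 * k + 2)) := by positivity
  rw [Real.rpow_one, div_le_iff₀ (by linarith)]
  nlinarith

/-- Eventually `T n ≤ n log log n / 8`, hence `2 ^ (4k + 2) ≤ 4 √(log n)`. With `u = √(log n) / 4`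
the inner power is at least `exp u ≥ u ^ 3 / 6`, which outgrows `a log n = 16 a u ^ 2`. -/
theorem eventually_pow_lt_two_rpow {T : ℕ → ℕ}
    (hT : (fun n => (T n : ℝ)) =o[atTop] (fun n : ℕ => (n : ℝ) * Real.log (Real.log n))) (a : ℕ) :
    ∀ᶠ n : ℕ in atTop, (n : ℝ) ^ a <
      (2 : ℝ) ^ ((n : ℝ) ^ (1 / (2 : ℝ) ^ (4 * ((T n : ℝ) / n) + 2)) / 768) := by
  have hlog : Tendsto (fun n : ℕ => Real.log n) atTop atTop :=
    Real.tendsto_log_atTop.comp tendsto_natCast_atTop_atTop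
  have hsqrt : Tendsto (fun n : ℕ => √(Real.log n) / 4) atTop atTop :=
    (Real.tendsto_sqrt_atTop.comp hlog).atTop_div_const (by norm_num)
  filter_upwards [hT.def (by norm_num : (0 : ℝ) < 1 / 8), hlog.eventually_ge_atTop 1,
    hsqrt.eventually_gt_atTop (6 * 1536 * 16 * a), eventually_ge_atTop 1] with n h1 h2 h3 h4
  have hn0 : (0 : ℝ) < n := by exact_mod_cast h4
  set ℓ := Real.log n with hℓ
  set k : ℝ := (T n : ℝ) / n with hk
  have hll : 0 ≤ Real.log ℓ := Real.log_nonneg h2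
  have hk0 : 0 ≤ k := by positivity
  have hk1 : 4 * k ≤ Real.log ℓ / 2 := by
    rw [Real.norm_of_nonneg (by positivity), Real.norm_of_nonneg (by positivity)] at h1
    have : k ≤ 1 / 8 * Real.log ℓ := by
      rw [hk, div_le_iff₀ hn0]
      linarith
    linarith
  have hexp : (2 : ℝ) ^ (4 * k + 2) ≤ 4 * √ℓ := by
    have e1 : (2 : ℝ) ^ (4 * k + 2) = 4 * (2 : ℝ) ^ (4 * k) := by
      rw [Real.rpow_add two_pos]
      norm_num
      ring
    rw [e1]
    gcongr
    calc (2 : ℝ) ^ (4 * k) ≤ Real.exp 1 ^ (4 * k) := by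
          have := Real.add_one_le_exp 1
          gcongr
          linarith
      _ = Real.exp (4 * k) := by rw [← Real.exp_mul, one_mul]
      _ ≤ Real.exp (Real.log ℓ / 2) := Real.exp_le_exp.2 hk1
      _ = √ℓ := by rw [Real.sqrt_eq_rpow, Real.rpow_def_of_pos (by linarith)]; ring_nf
  have hs0 : 0 < √ℓ := Real.sqrt_pos.2 (by linarith)
  set u := √ℓ / 4 with hu
  have hu0 : 0 < u := by positivity
  have hℓu : ℓ = 16 * u ^ 2 := by
    rw [hu, div_pow, Real.sq_sqrt (by linarith)]
    ring
  have hne : Real.exp u ≤ (n : ℝ) ^ (1 / (2 : ℝ) ^ (4 * k + 2)) := by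
    rw [Real.rpow_def_of_pos hn0, ← hℓ]
    refine Real.exp_le_exp.2 ?_
    rw [mul_one_div, le_div_iff₀ (by positivity)]
    calc u * 2 ^ (4 * k + 2) ≤ u * (4 * √ℓ) := by gcongr
      _ = ℓ := by rw [hu]; nlinarith [Real.mul_self_sqrt (by linarith : 0 ≤ ℓ)]
  have hcube := Real.pow_div_factorial_le_exp u hu0.le 3
  have hlin : a * ℓ < Real.log 2 * ((n : ℝ) ^ (1 / (2 : ℝ) ^ (4 * k + 2)) / 768) := by
    have e1 : u ^ 3 = u ^ 2 * u := by ring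
    have e2 : u ^ 2 * (6 * 1536 * 16 * a) < u ^ 2 * u := by gcongr
    have e3 : u ^ 3 / 6 ≤ (n : ℝ) ^ (1 / (2 : ℝ) ^ (4 * k + 2)) := by
      refine le_trans ?_ hne
      simpa [Nat.factorial] using hcube
    have e4 : (1 / 2 : ℝ) ≤ Real.log 2 := by have := Real.log_two_gt_d9; linarith
    have e5 : (1 / 2 : ℝ) * ((n : ℝ) ^ (1 / (2 : ℝ) ^ (4 * k + 2)) / 768) ≤
        Real.log 2 * ((n : ℝ) ^ (1 / (2 : ℝ) ^ (4 * k + 2)) / 768) := by gcongr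
    rw [hℓu]
    linarith
  rw [Real.rpow_def_of_pos two_pos]
  calc (n : ℝ) ^ a = Real.exp (a * ℓ) := by rw [mul_comm, Real.exp_mul, hℓ, Real.exp_log hn0,
        Real.rpow_natCast]
    _ < _ := Real.exp_lt_exp.2 hlin

theorem eventually_pow_lt_size (T : ℕ → ℕ)
    (hT : (fun n => (T n : ℝ)) =o[atTop] (fun n : ℕ => (n : ℝ) * Real.log (Real.log n))) (a : ℕ) :
    ∀ᶠ n : ℕ in atTop, ∀ B : BranchingProgram n (InputValue n) Bool,
      B.IsDeterministic → B.IsOblivious → B.LengthLE (T n) → B.Computes (medianBit n) →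
        n ^ a < B.size := by
  filter_upwards [eventually_pow_lt_two_rpow hT a, eventually_ge_atTop 2] with n h1 h2 B hB hO hL hf
  have hn0 : (n : ℝ) ≠ 0 := by exact_mod_cast (by omega : n ≠ 0)
  have := h1.trans_le (two_rpow_le_size h2 (div_mul_cancel₀ _ hn0).ge hB hO hL hf)
  exact_mod_cast this

/-! ### The nondeterministic program. -/

namespace MedianGuess

/-- The nodes of the program that guesses the median: the number of inputs read, the guess, the
number of inputs read that are smaller than the guess, and the number of those that are at most
the guess. -/
abbrev Node (n : ℕ) : Type := Fin (n + 1) × InputValue n × Fin (n + 1) × Fin (n + 1)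

/-- Reading the input value `d`; the guess is made when the first value is read. -/
def Step {n : ℕ} (a : Node n) (d : InputValue n) (b : Node n) : Prop :=
  (b.1 : ℕ) = a.1 + 1 ∧ ((a.1 : ℕ) = 0 ∨ b.2.1 = a.2.1) ∧
    (b.2.2.1 : ℕ) = a.2.2.1 + (if d < b.2.1 then 1 else 0) ∧
    (b.2.2.2 : ℕ) = a.2.2.2 + (if d ≤ b.2.1 then 1 else 0)

/-- The source. -/
def start {n : ℕ} (hn : 0 < n) : Node n := (0, toInputValue hn 1, 0, 0)

/-- The nodes that can be reached from the source. -/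
abbrev Reachable {n : ℕ} (hn : 0 < n) (a : Node n) : Prop :=
  Relation.ReflTransGen (fun a b => ∃ d, Step a d b) (start hn) a

open Classical in
/-- The program that guesses the median, verifies the guess, and accepts if the low-order bit of the
guess is `β`. -/
noncomputable def program {n : ℕ} (hn : 0 < n) (β : Bool) :
    BranchingProgram n (InputValue n) Bool where
  -- Unreachable nodes are dropped to make the graph connected.
  V := {a : Node n // Reachable hn a}
  source := ⟨start hn, .refl⟩
  label := fun a => if h : (a.1.1 : ℕ) < n then Sum.inl ⟨a.1.1, h⟩ else
    Sum.inr (decide ((a.1.2.1 : ℕ).testBit 0 = β ∧ (a.1.2.2.1 : ℕ) ≤ n / 2 ∧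
      n / 2 < (a.1.2.2.2 : ℕ)))
  Edge := fun a d b => Step a.1 d b.1
  sink_no_edge := by
    rintro ⟨a, ha⟩ r d ⟨b, hb⟩ h hs
    have h1 : ¬ (a.1 : ℕ) < n := fun h' => by simp [h'] at h
    have h2 := b.1.2
    have h3 := hs.1
    simp only at h3
    omega
  acyclic := by
    have h : ∀ a b : {a : Node n // Reachable hn a},
        Relation.TransGen (fun a b => ∃ d, Step a.1 d b.1) a b → (a.1.1 : ℕ) < b.1.1 := by
      intro a b hab
      induction hab with
      | single h =>
        obtain ⟨d, hd⟩ := h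
        rw [hd.1]
        exact Nat.lt_succ_self _
      | tail _ h ih =>
        obtain ⟨d, hd⟩ := h
        rw [hd.1]
        exact ih.trans (Nat.lt_succ_self _)
    exact fun a ha => lt_irrefl _ (h a a ha)
  connected := by
    have h : ∀ a (ha : Reachable hn a), Relation.EqvGen
        (fun a b : {a : Node n // Reachable hn a} => ∃ d, Step a.1 d b.1)
        ⟨start hn, .refl⟩ ⟨a, ha⟩ := by
      intro a ha
      induction ha with
      | refl => exact .refl _
      | tail hb hs ih => exact (ih).trans _ _ _ (.rel _ _ hs)
    exact fun u v => ((h u.1 u.2).symm _ _).trans _ _ _ (h v.1 v.2)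

variable {n : ℕ} {hn : 0 < n} {β : Bool}

theorem label_eq_inl {a : (program hn β).V} {i : Fin n} (h : (program hn β).label a = Sum.inl i) :
    (a.1.1 : ℕ) = i := by
  simp only [program] at h
  split_ifs at h
  rw [← Sum.inl.inj h]

theorem label_eq_inr {a : (program hn β).V} {r : Bool} (h : (program hn β).label a = Sum.inr r) :
    (a.1.1 : ℕ) = n ∧ r = decide ((a.1.2.1 : ℕ).testBit 0 = β ∧ (a.1.2.2.1 : ℕ) ≤ n / 2 ∧
      n / 2 < (a.1.2.2.2 : ℕ)) := by
  have h2 := a.1.1.2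
  simp only [program] at h
  split_ifs at h with h1
  refine ⟨by omega, (Sum.inr.inj h).symm.trans ?_⟩
  congr

/-- The first component is both a clock and the index queried, so every full path reads the inputs
once in their order. -/
theorem map_val_eq_of_isPath {u v : (program hn β).V} {s : List (Fin n)}
    (h : (program hn β).IsPath u s v) :
    (v.1.1 : ℕ) = u.1.1 + s.length ∧ s.map Fin.val = List.range' u.1.1 s.length := by
  induction h with
  | nil v => simp
  | @cons u v w i d s hi he _ ih =>
    have h1 : (v.1.1 : ℕ) = u.1.1 + 1 := he.1
    have h2 := label_eq_inl hi
    rw [List.map_cons, ih.2, List.length_cons, List.range'_succ, ih.1, h1, h2]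
    exact ⟨by omega, rfl⟩

theorem map_val_eq {s : List (Fin n)} (h : (program hn β).IsSourceSinkSeq s) :
    s.map Fin.val = List.range' 0 n := by
  obtain ⟨v, r, hv, hp⟩ := h
  obtain ⟨h1, h2⟩ := map_val_eq_of_isPath hp
  have h3 : (((program hn β).source.1.1 : Fin (n + 1)) : ℕ) = 0 := rfl
  rw [(label_eq_inr hv).1, h3, zero_add] at h1
  rw [h2, h3, ← h1]

theorem isOblivious : (program hn β).IsOblivious := fun _ _ hs ht =>
  List.map_injective_iff.2 Fin.val_injective ((map_val_eq hs).trans (map_val_eq ht).symm)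

theorem isReadOnce : (program hn β).IsReadOnce := fun s hs =>
  List.Nodup.of_map Fin.val (map_val_eq hs ▸ List.nodup_range')

theorem lengthLE : (program hn β).LengthLE n := fun s hs => by
  have := congrArg List.length (map_val_eq hs)
  simp at this
  omega

theorem size_le : (program hn β).size ≤ 16 * n ^ 4 := by
  have h : Fintype.card (program hn β).V ≤ Fintype.card (Node n) :=
    Fintype.card_le_of_injective (fun a => a.1) Subtype.val_injective
  refine h.trans ?_
  simp only [Fintype.card_prod, Fintype.card_fin, Fintype.card_coe, Nat.card_Icc,
    Nat.add_sub_cancel]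
  have h1 : n + 1 ≤ 2 * n := by omega
  calc (n + 1) * (2 * n * ((n + 1) * (n + 1))) ≤ (2 * n) * (2 * n * ((2 * n) * (2 * n))) := by
        gcongr
    _ = 16 * n ^ 4 := by ring

/-- The number of the first `τ` inputs with the property `p`. -/
def countBelow (n τ : ℕ) (p : Fin n → Prop) [DecidablePred p] : ℕ :=
  (Finset.univ.filter fun i : Fin n => (i : ℕ) < τ ∧ p i).card

theorem countBelow_zero (p : Fin n → Prop) [DecidablePred p] : countBelow n 0 p = 0 := by
  simp [countBelow]

theorem countBelow_self (p : Fin n → Prop) [DecidablePred p] :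
    countBelow n n p = (Finset.univ.filter p).card := by
  simp [countBelow]

theorem countBelow_le (τ : ℕ) (p : Fin n → Prop) [DecidablePred p] : countBelow n τ p ≤ n :=
  (Finset.card_le_univ _).trans_eq (Fintype.card_fin n)

theorem countBelow_succ (i : Fin n) (p : Fin n → Prop) [DecidablePred p] :
    countBelow n (i + 1) p = countBelow n i p + if p i then 1 else 0 := by
  unfold countBelow
  split_ifs with h
  · rw [← Finset.card_insert_of_notMem (a := i) (by simp)]
    congr 1
    ext j
    simp only [Finset.mem_filter, Finset.mem_univ, true_and, Finset.mem_insert, Fin.ext_iff]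
    constructor
    · rintro ⟨h1, h2⟩
      by_cases hj : (j : ℕ) = i
      · exact Or.inl hj
      · exact Or.inr ⟨by omega, h2⟩
    · rintro (h1 | ⟨h1, h2⟩)
      · rw [Fin.ext h1]
        exact ⟨by omega, h⟩
      · exact ⟨by omega, h2⟩
  · rw [add_zero]
    congr 1
    ext j
    simp only [Finset.mem_filter, Finset.mem_univ, true_and]
    constructor
    · rintro ⟨h1, h2⟩
      have hj : (j : ℕ) ≠ i := fun hj => h (Fin.ext hj ▸ h2)
      exact ⟨by omega, h2⟩
    · rintro ⟨h1, h2⟩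
      exact ⟨by omega, h2⟩

theorem counts_of_reaches {x : Fin n → InputValue n} {a : (program hn β).V}
    (h : (program hn β).Reaches x a) :
    (a.1.2.2.1 : ℕ) = countBelow n a.1.1 (fun i => x i < a.1.2.1) ∧
      (a.1.2.2.2 : ℕ) = countBelow n a.1.1 (fun i => x i ≤ a.1.2.1) := by
  induction h with
  | refl => exact ⟨(countBelow_zero _).symm, (countBelow_zero _).symm⟩
  | @tail a b _ hs ih =>
    obtain ⟨i, hi, h1, h2, h3, h4⟩ := hs
    have hai := label_eq_inl hi
    rw [h3, h4, h1, hai, countBelow_succ, countBelow_succ, ih.1, ih.2, hai]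
    -- At the first step the guess may change, but both counts are still zero whatever the guess.
    rcases h2 with h2 | h2
    · rw [hai] at h2
      simp [h2, countBelow_zero]
    · rw [h2]
      exact ⟨rfl, rfl⟩

theorem exists_reaches (x : Fin n → InputValue n) (v : InputValue n) {τ : ℕ} (hτ : τ ≤ n) :
    ∃ a : (program hn β).V, (program hn β).Reaches x a ∧ (a.1.1 : ℕ) = τ ∧
      (τ = 0 ∨ a.1.2.1 = v) := by
  induction τ with
  | zero => exact ⟨_, .refl, rfl, Or.inl rfl⟩
  | succ τ ih =>
    obtain ⟨a, ha, hat, hav⟩ := ih (by omega)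
    obtain ⟨c1, c2⟩ := counts_of_reaches ha
    rw [hat] at c1 c2
    have hlt : (a.1.1 : ℕ) < n := by omega
    let b : Node n := (⟨τ + 1, by omega⟩, v,
      ⟨countBelow n (τ + 1) (fun i => x i < v), Nat.lt_succ_of_le (countBelow_le _ _)⟩,
      ⟨countBelow n (τ + 1) (fun i => x i ≤ v), Nat.lt_succ_of_le (countBelow_le _ _)⟩)
    have hcount : ∀ p q : Fin n → Prop, ∀ _ : DecidablePred p, ∀ _ : DecidablePred q,
        (τ = 0 ∨ p = q) → countBelow n τ p = countBelow n τ q := by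
      intro p q _ _ h
      rcases h with rfl | rfl
      · rw [countBelow_zero, countBelow_zero]
      · congr
    have hs : Step a.1 (x ⟨a.1.1, hlt⟩) b := by
      have e1 := countBelow_succ (⟨τ, by omega⟩ : Fin n) fun i => x i < v
      have e2 := countBelow_succ (⟨τ, by omega⟩ : Fin n) fun i => x i ≤ v
      have hidx : (⟨a.1.1, hlt⟩ : Fin n) = ⟨τ, by omega⟩ := Fin.ext hat
      refine ⟨by rw [hat], ?_, ?_, ?_⟩
      · rw [hat]
        exact hav.imp id Eq.symm
      · rw [c1, hidx, hcount _ (fun i => x i < v) _ _ (hav.imp id fun h => by rw [h])]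
        exact e1
      · rw [c2, hidx, hcount _ (fun i => x i ≤ v) _ _ (hav.imp id fun h => by rw [h])]
        exact e2
    refine ⟨⟨b, a.2.tail ⟨_, hs⟩⟩, ha.tail ⟨⟨a.1.1, hlt⟩, dif_pos hlt, hs⟩, rfl, Or.inr rfl⟩

/-- By `median_eq_iff` only the true median passes the verification. Hence a wrong guess never
accepts, and either value of the bit can be tested. -/
theorem nondetComputes : (program hn β).NondetComputes fun x => medianBit n x == β := by
  intro x
  rw [beq_iff_eq, medianBit_eq hn]
  constructor
  · intro h
    obtain ⟨a, ha, hat, hav⟩ := exists_reaches (hn := hn) (β := β) x (median hn x) le_rfl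
    have hav := hav.resolve_left hn.ne'
    obtain ⟨c1, c2⟩ := counts_of_reaches ha
    rw [hat, hav, countBelow_self] at c1 c2
    obtain ⟨m1, m2⟩ := (median_eq_iff hn x _).1 rfl
    refine ⟨a, ha, (dif_neg (by omega)).trans ?_⟩
    rw [Sum.inr.injEq, decide_eq_true_iff]
    rw [hav, c1, c2]
    exact ⟨h, m1, m2⟩
  · rintro ⟨a, ha, hl⟩
    obtain ⟨hat, hr⟩ := label_eq_inr hl
    obtain ⟨h1, h2, h3⟩ := decide_eq_true_iff.1 hr.symm
    obtain ⟨c1, c2⟩ := counts_of_reaches ha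
    rw [hat, countBelow_self] at c1 c2
    rw [(median_eq_iff hn x a.1.2.1).2 ⟨c1 ▸ h2, c2 ▸ h3⟩, h1]

end MedianGuess

theorem exists_nondet_medianBit {n : ℕ} (hn : 0 < n) :
    (∃ B : BranchingProgram n (InputValue n) Bool, B.IsOblivious ∧ B.IsReadOnce ∧ B.LengthLE n ∧
      B.NondetComputes (medianBit n) ∧ B.size ≤ 16 * n ^ 4) ∧
    (∃ B : BranchingProgram n (InputValue n) Bool, B.IsOblivious ∧ B.IsReadOnce ∧ B.LengthLE n ∧
      B.NondetComputes (fun x => !(medianBit n x)) ∧ B.size ≤ 16 * n ^ 4) := by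
  refine ⟨⟨MedianGuess.program hn true, MedianGuess.isOblivious, MedianGuess.isReadOnce,
    MedianGuess.lengthLE, ?_, MedianGuess.size_le⟩, ⟨MedianGuess.program hn false,
    MedianGuess.isOblivious, MedianGuess.isReadOnce, MedianGuess.lengthLE, ?_,
    MedianGuess.size_le⟩⟩
  · have h := MedianGuess.nondetComputes (hn := hn) (β := true)
    simpa using h
  · have h := MedianGuess.nondetComputes (hn := hn) (β := false)
    simpa using h

/-! ### Separation of the classes. -/

theorem mem_obliviousNP_of_le {f : BoolFamily} {T : ℕ → ℕ} (hT : ∀ n, 1 ≤ n → n ≤ T n)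
    (h : ∀ n, 1 ≤ n → ∃ B : BranchingProgram n (InputValue n) Bool, B.IsOblivious ∧
      B.IsReadOnce ∧ B.LengthLE n ∧ B.NondetComputes (f n) ∧ B.size ≤ 16 * n ^ 4) :
    f ∈ ObliviousNP T := by
  refine ⟨16, fun n hn => ?_⟩
  obtain ⟨B, h1, -, h3, h4, h5⟩ := h n hn
  refine ⟨B, h1, fun s hs => (h3 s hs).trans (hT n hn), h4, h5.trans ?_⟩
  exact Nat.mul_le_mul_left _ (Nat.pow_le_pow_right hn (by norm_num))

theorem medianBit_notMem_obliviousP {T : ℕ → ℕ}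
    (hT : (fun n => (T n : ℝ)) =o[atTop] (fun n : ℕ => (n : ℝ) * Real.log (Real.log n))) :
    medianBit ∉ ObliviousP T := by
  rintro ⟨c, hc⟩
  obtain ⟨n, h1, h2, h3⟩ := ((eventually_pow_lt_size T hT (c + 1)).and
    ((eventually_ge_atTop c).and (eventually_ge_atTop 1))).exists
  obtain ⟨B, hB, hO, hL, hf, hs⟩ := hc n h3
  have h4 := h1 B hB hO hL hf
  have h5 : c * n ^ c ≤ n ^ (c + 1) := by
    rw [pow_succ']
    gcongr
  omega

theorem mainTheorem3 :
    -- the size lower bound, with absolute constants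
    (∃ c C : ℝ, 0 < c ∧ 0 < C ∧ ∀ (k : ℝ) (n T : ℕ), 2 ≤ n → (T : ℝ) ≤ k * n →
      ∀ B : BranchingProgram n (InputValue n) Bool,
        B.IsDeterministic → B.IsOblivious → B.LengthLE T → B.Computes (medianBit n) →
          (2 : ℝ) ^ (c * (n : ℝ) ^ (1 / (2 : ℝ) ^ (4 * k + 2)) / Real.log n ^ C) ≤ B.size) ∧
    -- the size is super-polynomial for length o(n log log n)
    (∀ T : ℕ → ℕ,
      (fun n => (T n : ℝ)) =o[atTop] (fun n : ℕ => (n : ℝ) * Real.log (Real.log n)) →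
      ∀ a : ℕ, ∀ᶠ n : ℕ in atTop, ∀ B : BranchingProgram n (InputValue n) Bool,
        B.IsDeterministic → B.IsOblivious → B.LengthLE (T n) → B.Computes (medianBit n) →
          n ^ a < B.size) ∧
    -- the nondeterministic upper bound for the function and its complement
    (∃ K : ℕ, ∀ n : ℕ, 1 ≤ n →
      (∃ B : BranchingProgram n (InputValue n) Bool,
        B.IsOblivious ∧ B.IsReadOnce ∧ B.LengthLE n ∧ B.NondetComputes (medianBit n) ∧
          B.size ≤ K * n ^ 4) ∧
      (∃ B : BranchingProgram n (InputValue n) Bool,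
        B.IsOblivious ∧ B.IsReadOnce ∧ B.LengthLE n ∧
          B.NondetComputes (fun x => !(medianBit n x)) ∧ B.size ≤ K * n ^ 4)) ∧
    -- the analog of P ≠ NP ∩ coNP
    (∀ T : ℕ → ℕ, (∀ n, 1 ≤ n → n ≤ T n) →
      (fun n => (T n : ℝ)) =o[atTop] (fun n : ℕ => (n : ℝ) * Real.log (Real.log n)) →
      medianBit ∈ ObliviousNP T ∩ ObliviousCoNP T ∧ medianBit ∉ ObliviousP T ∧
        ObliviousP T ≠ ObliviousNP T ∩ ObliviousCoNP T) := by
  refine ⟨exists_two_rpow_div_log_le_size, eventually_pow_lt_size,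
    ⟨16, fun n hn => exists_nondet_medianBit hn⟩, fun T hT hTo => ?_⟩
  have h1 : medianBit ∈ ObliviousNP T ∩ ObliviousCoNP T :=
    ⟨mem_obliviousNP_of_le hT fun n hn => (exists_nondet_medianBit hn).1,
      mem_obliviousNP_of_le hT fun n hn => (exists_nondet_medianBit hn).2⟩
  have h2 := medianBit_notMem_obliviousP hTo
  exact ⟨h1, h2, fun h => h2 (h ▸ h1)⟩
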